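/- **Conventions.** Link diagrams are drawn on the sphere. At a crossing $c$ we fix compass directions: the four ends of its strands are NE, NW, SW, SE. Put $\operatorname{sign}(c)=1$ if the overstrand runs from SW to NE and $\operatorname{sign}(c)=-1$ if it runs from NW to SE. The $A$-smoothing at a crossing joins the two regions that are swept out when the overstrand is rotated counterclockwise until it meets the understrand; the $B$-smoothing joins the other two. Given a checkerboard colouring of the regions of a diagram, the Tait graph $G$ has the shaded regions as vertices and one edge for each crossing, joining the two shaded regions that meet there. An edge is positive if the $A$-smoothing at its crossing joins the two unshaded regions (so that this smoothing deletes the edge), and negative otherwise. Let $s_v$ be the number of spanning trees of $G$ with exactly $v$ positive edges. The determinant of a connected diagram is $\left|\sum_v(-1)^v s_v\right|$, which does not depend on the colouring; the determinant of a disconnected diagram (a split link) is $0$. For nonzero integers $a_1,\dots,a_n$ $(n\ge 1)$ of the same sign, the rational tangle with denominators $[a_1,\dots,a_n]$ is Conway's tangle $a_1a_2\cdots a_n$: begin with $|a_1|$ horizontal crossings, each of the sign of $a_1$; then, for $i=2,\dots,n$ in turn, reflect in the vertical plane through the line NW–SE and add $|a_i|$ horizontal crossings, each of the sign of $a_i$,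 on the east side. Its slope is $$\frac{\beta}{\alpha}=\cfrac{1}{a_n+\cfrac{1}{a_{n-1}+\cfrac{1}{\ddots+\cfrac{1}{a_1}}}},\qquad \alpha>0,\quad \gcd(\alpha,\beta)=1 .$$ **Lemma 2.2.** Let $c$ be a crossing of a diagram of a link $L$, and let $L_0$ and $L_1$ be the links obtained by the $A$- and the $B$-smoothing at $c$. Choose a checkerboard colouring of the diagram of $L$ for which the edge of $c$ is positive, give the diagrams of $L_0$ and $L_1$ the induced colourings, and put $$x=\sum_v(-1)^v s_{v-1}(L_0),\qquad y=\sum_v(-1)^v s_v(L_1).$$ Let $L^*$ be the link obtained from $L$ by replacing $c$ by a rational tangle of slope $\beta/\alpha$ with denominators $a_1,\dots,a_n$ that all have the same sign as $c$. Then $$\det(L^*)=\begin{cases}\bigl|\,\alpha\det(L_0)+\operatorname{sign}(xy)\,\beta\,\det(L_1)\,\bigr| & \text{if }\operatorname{sign}(c)=1,\\[2pt] \bigl|\,\alpha\det(L_1)+\operatorname{sign}(xy)\,|\beta|\,\det(L_0)\,\bigr| & \text{if }\operatorname{sign}(c)=-1,\end{cases}$$ where $\operatorname{sign}(0)$ is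 read as $1$. -/

import Mathlib

/-! Link diagrams on the sphere, their Tait graphs and determinants, rational tangles.

Every node of a diagram sits in a small disc with four ports in counterclockwise order,
`0 = NE`, `1 = NW`, `2 = SW`, `3 = SE`.  The corner `i` of a node is the sector between the
ports `i` and `i + 1`, so `0 = N`, `1 = W`, `2 = S`, `3 = E`.  (Arithmetic in `Fin 4` is mod 4.) -/

/-- What is drawn inside the disc of a node: a crossing, or the result of smoothing one. -/
inductive Elem where
  /-- the crossing of sign `1`: the overstrand runs from SW to NE (positive slope) -/
  | pos
  /-- the crossing of sign `-1`: the overstrand runs from NW to SE (negative slope) -/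
  | neg
  /-- the two arcs `)(`, that is NW to SW and NE to SE -/
  | vert
  /-- two horizontal arcs, NW to NE and SW to SE -/
  | horiz

namespace Elem

/-- The element is a crossing. -/
def IsCrossing (e : Elem) : Prop := e = pos ∨ e = neg

/-- The `A`-smoothing: it opens a channel between the two regions swept out when the overstrand
is rotated counterclockwise (N and S for `pos`, W and E for `neg`). -/
def smoothA : Elem → Elem
  | pos => vert
  | neg => horiz
  | e => e

/-- The `B`-smoothing, the other one. -/
def smoothB : Elem → Elem
  | pos => horiz
  | neg => vert
  | e => e

/-- Ports `i`, `j` of a node lie on a common piece of the projection inside the disc. -/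
def PortsJoined : Elem → Fin 4 → Fin 4 → Prop
  | pos, _, _ => True
  | neg, _, _ => True
  | vert, i, j => j = i ∨ j = 3 - i
  | horiz, i, j => j = i ∨ j = 1 - i

/-- Corners `i`, `j` of a node belong to the same region already inside the disc. -/
def CornersJoined : Elem → Fin 4 → Fin 4 → Prop
  | vert, i, j => i = 0 ∧ j = 2
  | horiz, i, j => i = 1 ∧ j = 3
  | _, _, _ => False

/-- Reflection in the vertical plane through the line NW-SE.  Overstrands stay over, and the
slopes of the strands of a crossing do not change. -/
def reflect : Elem → Elem
  | vert => horiz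
  | horiz => vert
  | e => e

end Elem

/-- A diagram: finitely many nodes, whose ports are joined in pairs by arcs without crossings.
It is drawn on the closed oriented surface obtained by gluing a disc to each boundary walk; this
surface is a union of spheres if `Diagram.IsPlanar` holds.  The nodes that are crossings are the
crossings of the diagram; the smoothed nodes are just places where arcs pass (they record
smoothings, and allow components without crossings). -/
structure Diagram where
  Node : Type
  finite : Finite Node
  elem : Node → Elem
  glue : Node × Fin 4 → Node × Fin 4
  glue_glue : ∀ p, glue (glue p) = p
  glue_ne : ∀ p, glue p ≠ p

/-- A finite set of edges is a spanning tree: it connects all vertices and it has no cycle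
(no edge of it joins two vertices that are connected by the other edges of it). -/
def Graph.IsSpanningTree {V E : Type*} (G : Graph V E) (S : Set E) : Prop :=
  S ⊆ G.edgeSet ∧
  (∀ u ∈ G.vertexSet, ∀ v ∈ G.vertexSet,
    Relation.ReflTransGen (fun a b => ∃ e ∈ S, G.IsLink e a b) u v) ∧
  (∀ e ∈ S, ∀ u v, G.IsLink e u v →
    ¬ Relation.ReflTransGen (fun a b => ∃ f ∈ S \ {e}, G.IsLink f a b) u v)

namespace Diagram

/-- Ports, and likewise corners, of the nodes. -/
abbrev Flag (D : Diagram) : Type := D.Node × Fin 4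

/-- The corner `i` lies on the counterclockwise side of the port `i`.  Following that side of the
arc which starts at port `i` of `x` and ends at port `j` of `y`, one comes to corner `j - 1`
of `y`. -/
def across (D : Diagram) (q : D.Flag) : D.Flag := ((D.glue q).1, (D.glue q).2 - 1)

/-- Euler's formula `V - E + F = 2 C` for the 4-valent graph formed by the nodes and the arcs
(with `E = 2 V`, `F` boundary walks and `C` connected components): each component of the surface
that carries the diagram is a sphere. -/
def IsPlanar (D : Diagram) : Prop :=
  Nat.card D.Node + 2 * Nat.card (Quot fun x y : D.Node => ∃ i, (D.glue (x, i)).1 = y) =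
    Nat.card (Quot fun q r : D.Flag => r = D.across q)

/-- The projection of the link is connected. -/
def IsConnected (D : Diagram) : Prop :=
  ∀ p q : D.Flag, Relation.ReflTransGen
    (fun a b => b = D.glue a ∨ a.1 = b.1 ∧ (D.elem a.1).PortsJoined a.2 b.2) p q

/-- Two corners are adjacent parts of the same region: along an arc, or through a channel that a
smoothing opens. -/
def SameRegion (D : Diagram) (q r : D.Flag) : Prop :=
  r = D.across q ∨ q.1 = r.1 ∧ (D.elem q.1).CornersJoined q.2 r.2

/-- The regions of the diagram. -/
def Region (D : Diagram) : Type := Quot D.SameRegion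

/-- The region of a corner. -/
def region (D : Diagram) (q : D.Flag) : D.Region := Quot.mk _ q

/-- A set `σ` of corners (the shaded ones) is a checkerboard colouring: it is constant on regions,
and the two sides of every arc have different colours. -/
def IsCheckerboard (D : Diagram) (σ : Set D.Flag) : Prop :=
  (∀ x i, (x, i + 1) ∈ σ ↔ (x, i) ∉ σ) ∧ ∀ q, D.across q ∈ σ ↔ q ∈ σ

/-- The Tait graph of a diagram with a checkerboard colouring.  Vertices are the shaded regions;
each crossing is an edge that joins the two shaded regions at opposite corners of it. -/
def taitGraph (D : Diagram) (σ : Set D.Flag) : Graph D.Region D.Node where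
  vertexSet := {r | ∃ q ∈ σ, D.region q = r}
  IsLink x u v := (D.elem x).IsCrossing ∧
    ∃ i, (x, i) ∈ σ ∧ (x, i + 2) ∈ σ ∧ (∀ k, (x, k) ∈ σ → k = i ∨ k = i + 2) ∧
      D.region (x, i) = u ∧ D.region (x, i + 2) = v
  isLink_symm := by
    rintro x -
    refine ⟨?_⟩
    rintro u v ⟨hx, i, h1, h2, h3, h4, h5⟩
    have e : i + 2 + 2 = i := (by decide : ∀ i : Fin 4, i + 2 + 2 = i) i
    exact ⟨hx, i + 2, h2, by rwa [e], fun k hk => by rw [e]; exact (h3 k hk).symm, h5, by rwa [e]⟩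
  eq_or_eq_of_isLink_of_isLink := by
    rintro x u v u' v' ⟨-, i, -, -, h3, rfl, rfl⟩ ⟨-, j, g1, -, -, rfl, rfl⟩
    have e : i + 2 + 2 = i := (by decide : ∀ i : Fin 4, i + 2 + 2 = i) i
    rcases h3 j g1 with rfl | rfl
    · exact Or.inl rfl
    · right; rw [e]
  left_mem_of_isLink := by
    rintro x u v ⟨-, i, h1, -, -, h4, -⟩
    exact ⟨_, h1, h4⟩

/-- The edge of the crossing `x` is positive: the `A`-smoothing at `x` opens the channel between
the two unshaded corners, so it deletes the edge (and the `B`-smoothing contracts it). -/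
def IsPositiveEdge (D : Diagram) (σ : Set D.Flag) (x : D.Node) : Prop :=
  D.elem x = Elem.pos ∧ (x, 1) ∈ σ ∨ D.elem x = Elem.neg ∧ (x, 0) ∈ σ

/-- The number `s_v` of spanning trees of the Tait graph with exactly `v` positive edges. -/
noncomputable def treeCount (D : Diagram) (σ : Set D.Flag) (v : ℕ) : ℕ :=
  Set.ncard {S : Set D.Node | (D.taitGraph σ).IsSpanningTree S ∧
    Set.ncard {x ∈ S | D.IsPositiveEdge σ x} = v}

/-- The signed count `∑ (-1)^v s_v` of spanning trees.  A tree has at most as many edges as there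
are nodes, so the sum over all `v` is finite. -/
noncomputable def treeSum (D : Diagram) (σ : Set D.Flag) : ℤ :=
  ∑ v ∈ Finset.range (Nat.card D.Node + 1), (-1) ^ v * (D.treeCount σ v : ℤ)

/-- The shifted sum `∑ (-1)^v s_(v-1)` over `v ≥ 1`, written with `v + 1` for `v`. -/
noncomputable def shiftedTreeSum (D : Diagram) (σ : Set D.Flag) : ℤ :=
  ∑ v ∈ Finset.range (Nat.card D.Node + 1), (-1) ^ (v + 1) * (D.treeCount σ v : ℤ)

open Classical in
/-- The determinant of a link diagram: `|∑ (-1)^v s_v|` for the Tait graph of a checkerboard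
colouring.  For connected planar diagrams a colouring exists and the value does not depend on it.
A planar diagram that is not connected shows a split link, whose determinant is `0`. -/
noncomputable def det (D : Diagram) : ℕ :=
  if h : D.IsConnected ∧ ∃ σ, D.IsCheckerboard σ then (D.treeSum h.2.choose).natAbs else 0

open Classical in
/-- Redraw the node `c`. -/
noncomputable def setElem (D : Diagram) (c : D.Node) (e : Elem) : Diagram where
  Node := D.Node
  finite := D.finite
  elem := Function.update D.elem c e
  glue := D.glue
  glue_glue := D.glue_glue
  glue_ne := D.glue_ne

/-- `L₀`: the `A`-smoothing at `c`. -/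
noncomputable def smoothA (D : Diagram) (c : D.Node) : Diagram := D.setElem c (D.elem c).smoothA

/-- `L₁`: the `B`-smoothing at `c`. -/
noncomputable def smoothB (D : Diagram) (c : D.Node) : Diagram := D.setElem c (D.elem c).smoothB

open Classical in
/-- Where the ports of `D` are found after a new node `none` has been put on side `k` of `c`: it
takes over the arcs at the ports `k` and `k + 1` of `c`. -/
noncomputable def attachPort (D : Diagram) (c : D.Node) (k : Fin 4) (p : D.Flag) :
    Option D.Node × Fin 4 :=
  if p.1 = c ∧ (p.2 = k ∨ p.2 = k + 1) then (none, p.2) else (some p.1, p.2)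

open Classical in
/-- The arcs after a new node has been put on side `k` of `c`. The ports `k`, `k + 1` of `c` are
joined to the ports `k - 1`, `k + 2` of the new node, which face them; the ports `k`, `k + 1` of
the new node continue along the arcs that used to start at these ports of `c`. -/
noncomputable def attachGlue (D : Diagram) (c : D.Node) (k : Fin 4) :
    Option D.Node × Fin 4 → Option D.Node × Fin 4
  | (none, j) =>
      if j = k ∨ j = k + 1 then D.attachPort c k (D.glue (c, j))
      else if j = k + 2 then (some c, k + 1) else (some c, k)
  | (some x, j) =>
      if x = c ∧ j = k then (none, k - 1)
      else if x = c ∧ j = k + 1 then (none, k + 2)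
      else D.attachPort c k (D.glue (x, j))

theorem attachGlue_attachPort (D : Diagram) (c : D.Node) (k : Fin 4) (p : D.Flag) :
    D.attachGlue c k (D.attachPort c k p) = D.attachPort c k (D.glue p) := by
  obtain ⟨x, j⟩ := p
  by_cases h : x = c ∧ (j = k ∨ j = k + 1)
  · obtain ⟨rfl, h⟩ := h
    simp [attachPort, attachGlue, h]
  · have h1 : ¬ (x = c ∧ j = k) := fun h' => h ⟨h'.1, Or.inl h'.2⟩
    have h2 : ¬ (x = c ∧ j = k + 1) := fun h' => h ⟨h'.1, Or.inr h'.2⟩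
    have e : D.attachPort c k (x, j) = (some x, j) := if_neg h
    rw [e]
    simp only [attachGlue, if_neg h1, if_neg h2]

theorem attachPort_injective (D : Diagram) (c : D.Node) (k : Fin 4) :
    Function.Injective (D.attachPort c k) := by
  rintro ⟨x, i⟩ ⟨y, j⟩ h
  unfold attachPort at h
  split_ifs at h with h1 h2 h2 <;> simp_all

/-- Every port of the enlarged diagram is a port of `D` or faces a port of the other node. -/
theorem attach_cases (D : Diagram) (c : D.Node) (k : Fin 4) (q : Option D.Node × Fin 4) :
    (∃ p, q = D.attachPort c k p) ∨ q = (none, k - 1) ∨ q = (none, k + 2) ∨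
      q = (some c, k) ∨ q = (some c, k + 1) := by
  obtain ⟨_ | x, j⟩ := q
  · by_cases h : j = k ∨ j = k + 1
    · exact Or.inl ⟨(c, j), by simp [attachPort, h]⟩
    · have : j = k - 1 ∨ j = k + 2 := by revert j k; decide
      rcases this with rfl | rfl <;> simp
  · by_cases h : x = c ∧ (j = k ∨ j = k + 1)
    · obtain ⟨rfl, rfl | rfl⟩ := h <;> simp
    · exact Or.inl ⟨(x, j), (if_neg h).symm⟩

theorem attachGlue_inner (D : Diagram) (c : D.Node) (k : Fin 4) :
    D.attachGlue c k (none, k - 1) = (some c, k) ∧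
    D.attachGlue c k (none, k + 2) = (some c, k + 1) ∧
    D.attachGlue c k (some c, k) = (none, k - 1) ∧
    D.attachGlue c k (some c, k + 1) = (none, k + 2) := by
  have h1 : ¬ (k - 1 = k ∨ k - 1 = k + 1) ∧ k - 1 ≠ k + 2 := by revert k; decide
  have h2 : ¬ (k + 2 = k ∨ k + 2 = k + 1) := by revert k; decide
  have h3 : k + 1 ≠ k := by revert k; decide
  refine ⟨?_, ?_, ?_, ?_⟩
  · simp only [attachGlue, if_neg h1.1, if_neg h1.2]
  · simp only [attachGlue, if_neg h2, if_true]
  · simp only [attachGlue, and_self, if_true]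
  · simp only [attachGlue, h3, and_false, if_false, and_self, if_true]

/-- Put a new node, drawn as `e`, on side `k` of the node `c` (`k = 3` is the east side, `k = 2`
the south side), inside the disc that `c` used to fill. -/
noncomputable def attach (D : Diagram) (c : D.Node) (k : Fin 4) (e : Elem) : Diagram where
  Node := Option D.Node
  finite := by have := D.finite; infer_instance
  elem := fun x => x.elim e D.elem
  glue := D.attachGlue c k
  glue_glue := by
    obtain ⟨e1, e2, e3, e4⟩ := D.attachGlue_inner c k
    intro q
    rcases D.attach_cases c k q with ⟨p, rfl⟩ | rfl | rfl | rfl | rfl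
    · rw [attachGlue_attachPort, attachGlue_attachPort, D.glue_glue]
    · rw [e1, e3]
    · rw [e2, e4]
    · rw [e3, e1]
    · rw [e4, e2]
  glue_ne := by
    obtain ⟨e1, e2, e3, e4⟩ := D.attachGlue_inner c k
    intro q
    rcases D.attach_cases c k q with ⟨p, rfl⟩ | rfl | rfl | rfl | rfl
    · rw [attachGlue_attachPort]
      exact fun h => D.glue_ne p (D.attachPort_injective c k h)
    · rw [e1]; simp
    · rw [e2]; simp
    · rw [e3]; simp
    · rw [e4]; simp

end Diagram

/-- Tangle diagrams built from one elementary tangle by adding crossings, one at a time. -/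
inductive TwistTangle where
  | elem (e : Elem)
  /-- the sum `T + e`: the crossing `e` is put to the east of `T`, its NW and SW ports being
  joined to the NE and SE ends of `T` -/
  | addEast (T : TwistTangle) (e : Elem)
  /-- the crossing `e` is put to the south of `T`, its NW and NE ports being joined to the SW and
  SE ends of `T` -/
  | addSouth (T : TwistTangle) (e : Elem)

namespace TwistTangle

/-- Reflection in the vertical plane through the line NW-SE. -/
def reflect : TwistTangle → TwistTangle
  | elem e => elem e.reflect
  | addEast T e => addSouth T.reflect e.reflect
  | addSouth T e => addEast T.reflect e.reflect

/-- Add `|a|` horizontal crossings of the sign of `a` to the east of `T`. -/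
def twist (T : TwistTangle) (a : ℤ) : TwistTangle :=
  (fun T => addEast T (if 0 < a then Elem.pos else Elem.neg))^[a.natAbs] T

/-- Conway's rational tangle `a₁ a₂ … aₙ`: begin with `a₁` horizontal crossings; then, for
`i = 2, …, n`, reflect in the line NW-SE and add `aᵢ` horizontal crossings. -/
def rational (a : List ℤ) : TwistTangle :=
  a.foldl (fun T m => T.reflect.twist m) (elem Elem.vert)

end TwistTangle

/-- The value of the continued fraction `[a₁, …, aₙ]`, that is
`1 / (aₙ + 1 / (aₙ₋₁ + ⋯ + 1 / a₁))`: the slope of the rational tangle `a₁ a₂ … aₙ`. -/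
def contFrac (a : List ℤ) : ℚ := a.foldl (fun q m => 1 / (m + q)) 0

/-- Replace the node `c` of `D` by a tangle diagram, respecting the compass directions.  To put
`T + e` in the place of `c`, put `e` on the east side of `c` and then `T` in the place
of `c`. -/
noncomputable def Diagram.replace : (D : Diagram) → (c : D.Node) → TwistTangle → Diagram
  | D, c, .elem e => D.setElem c e
  | D, c, .addEast T e => Diagram.replace (D.attach c 3 e) (some c) T
  | D, c, .addSouth T e => Diagram.replace (D.attach c 2 e) (some c) T

/-- The sign of an integer, with value `1` at `0`. -/
def sgn (t : ℤ) : ℤ := if 0 ≤ t then 1 else -1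

namespace Diagram

open Relation

/-! Spanning trees are traded for states with a single circle. A state smooths every node and is
recorded by the set `U` of nodes whose shaded corners are merged, that is, whose edges are
contracted. On the sphere an edge set is a spanning tree of the Tait graph exactly when the shaded
regions, merged along its edges, form one disc, so that the state has one boundary circle
(`isSpanningTree_iff`). State circles run through ports, and these, unlike regions, stay the same
when a node is redrawn. The determinant becomes the absolute value of a weighted sum over one-circle
states (`det_eq_abs_stateSum`), where a contracted positive edge weighs `-1` and any other choice at
a crossing weighs `1`.

Sorting the states by what happens at `c` gives two partial sums that do not depend on the drawing
at `c` (`stateSum_split`). The edge of `c` is positive, so the A-smoothing deletes it and the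
B-smoothing contracts it: the determinants of `L₀` and `L₁` are the absolute values of the partial
sums for `false` and `true`. A tangle put in the place of `c` acts as one generalized edge with a
pair of weights. A crossing added to the tangle combines with it in series if the bigon between them
is shaded, and in parallel otherwise (`combine_attach`, `exists_stateSum_replace`). For a rational
tangle this recursion is the one of the continued fraction, and the weights are `α` and `-|β|` up to
a common sign (`weight_rational`). Hence the new determinant is `|α p - |β| q|`, where `p`, `q` are
the two partial sums, in an order that depends on the sign of `c`. The shift of the index in `x`
gives `x y = -p q` when neither vanishes, which turns this into the formula with absolute values. -/

theorem eqvGen_lift {X Y : Type*} {r : X → X → Prop} {s : Y → Y → Prop} (f : X → Y)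
    (h : ∀ a b, r a b → EqvGen s (f a) (f b)) {a b : X} (hab : EqvGen r a b) :
    EqvGen s (f a) (f b) := by
  induction hab with
  | rel a b hab => exact h a b hab
  | refl => exact .refl _
  | symm _ _ _ ih => exact ih.symm
  | trans _ _ _ _ _ h1 h2 => exact h1.trans _ _ _ h2

/-! ### Checkerboard colourings, states and state circles. -/

variable {D : Diagram} {σ : Set D.Flag}

theorem IsCheckerboard.mem_succ (h : D.IsCheckerboard σ) (x : D.Node) (i : Fin 4) :
    (x, i + 1) ∈ σ ↔ (x, i) ∉ σ := h.1 x i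

theorem IsCheckerboard.mem_pred (h : D.IsCheckerboard σ) (x : D.Node) (i : Fin 4) :
    (x, i - 1) ∈ σ ↔ (x, i) ∉ σ := by
  have := h.1 x (i - 1)
  rw [sub_add_cancel] at this
  tauto

theorem IsCheckerboard.mem_opp (h : D.IsCheckerboard σ) (x : D.Node) (i : Fin 4) :
    (x, i + 2) ∈ σ ↔ (x, i) ∈ σ := by
  have h1 := h.1 x i
  have h2 := h.1 x (i + 1)
  rw [add_assoc] at h2
  change (x, i + 2) ∈ σ ↔ _ at h2
  tauto

theorem IsCheckerboard.compl (h : D.IsCheckerboard σ) : D.IsCheckerboard σᶜ :=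
  ⟨fun x i => not_congr (h.1 x i), fun q => not_congr (h.2 q)⟩

/-- A port in `σ` has its shaded side counterclockwise; seen from the other end of the arc, that
side is clockwise. Membership in `σ` thus orients the strands. -/
theorem IsCheckerboard.glue_mem (h : D.IsCheckerboard σ) (p : D.Flag) :
    D.glue p ∈ σ ↔ p ∉ σ := by
  have h1 := h.2 p
  have h2 := h.mem_pred (D.glue p).1 (D.glue p).2
  unfold across at h1
  change _ ↔ D.glue p ∉ σ at h2
  tauto

open Classical in
/-- The other end of the arc that starts at the port `p`, when the nodes in `U` are smoothed so
that their shaded corners merge and all other nodes so that their unshaded corners merge. -/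
noncomputable def turn (D : Diagram) (σ : Set D.Flag) (U : Set D.Node) (p : D.Flag) : D.Flag :=
  if p ∈ σ ↔ p.1 ∉ U then (p.1, p.2 + 1) else (p.1, p.2 - 1)

theorem turn_succ {U : Set D.Node} {x : D.Node} {i : Fin 4} (h : (x, i) ∈ σ ↔ x ∉ U) :
    D.turn σ U (x, i) = (x, i + 1) := if_pos h

theorem turn_pred {U : Set D.Node} {x : D.Node} {i : Fin 4} (h : ¬ ((x, i) ∈ σ ↔ x ∉ U)) :
    D.turn σ U (x, i) = (x, i - 1) := if_neg h

theorem turn_fst (U : Set D.Node) (p : D.Flag) : (D.turn σ U p).1 = p.1 := by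
  unfold turn; split_ifs <;> rfl

theorem IsCheckerboard.turn_mem (h : D.IsCheckerboard σ) (U : Set D.Node) (p : D.Flag) :
    D.turn σ U p ∈ σ ↔ p ∉ σ := by
  unfold turn
  split_ifs
  · exact h.mem_succ _ _
  · exact h.mem_pred _ _

theorem IsCheckerboard.turn_turn (h : D.IsCheckerboard σ) (U : Set D.Node) (p : D.Flag) :
    D.turn σ U (D.turn σ U p) = p := by
  have h1 := h.turn_mem U p
  have h2 := turn_fst (σ := σ) U p
  rw [turn, h1, h2]
  obtain ⟨x, i⟩ := p
  by_cases hc : (x, i) ∈ σ ↔ x ∉ U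
  · rw [if_neg (by dsimp only; tauto)]
    simp [turn, hc]
  · rw [if_pos (by dsimp only; tauto)]
    simp [turn, hc]

/-- One step along a state circle; the arcs inside the nodes outside `A` are left out. -/
def CircleStep (D : Diagram) (σ : Set D.Flag) (U A : Set D.Node) (p q : D.Flag) : Prop :=
  q = D.glue p ∨ p.1 ∈ A ∧ q = D.turn σ U p

/-- A path that leaves a node comes back to it, at a port of the other colour. -/
theorem IsCheckerboard.exists_return (h : D.IsCheckerboard σ) (U : Set D.Node) (x : D.Node)
    (i : Fin 4) : ∃ j, ((x, j) ∈ σ ↔ (x, i) ∉ σ) ∧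
      EqvGen (D.CircleStep σ U {x}ᶜ) (x, i) (x, j) := by
  classical
  have := D.finite
  -- `f` follows an arc and then passes a node. Both `glue` and `turn` exchange the ports in `σ`
  -- with the others, so `f` preserves `σ`; being a permutation of a finite set, it comes back.
  set f : D.Flag → D.Flag := fun p => D.turn σ U (D.glue p) with hf
  have hinj : Function.Injective f :=
    Function.LeftInverse.injective (g := fun p => D.glue (D.turn σ U p)) fun p => by
      simp only [hf, h.turn_turn, D.glue_glue]
  have hmem : ∀ m, f^[m] (x, i) ∈ σ ↔ (x, i) ∈ σ := by
    intro m
    induction m with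
    | zero => rfl
    | succ m ih =>
      rw [Function.iterate_succ_apply', hf]
      rw [h.turn_mem, h.glue_mem, ih, not_not]
  have hex : ∃ m, (D.glue (f^[m] (x, i))).1 = x := by
    obtain ⟨n, hn, hp⟩ := hinj.mem_periodicPts (x, i)
    obtain ⟨m, rfl⟩ := Nat.exists_eq_succ_of_ne_zero hn.ne'
    refine ⟨m, ?_⟩
    have hp' : f^[m + 1] (x, i) = (x, i) := hp
    rw [Function.iterate_succ_apply'] at hp'
    rw [← turn_fst (σ := σ) U]
    exact congrArg Prod.fst hp'
  -- Stopping at the first return keeps the arcs inside `x` out of the path.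
  have hpath : ∀ k, k ≤ Nat.find hex →
      EqvGen (D.CircleStep σ U {x}ᶜ) (x, i) (f^[k] (x, i)) := by
    intro k
    induction k with
    | zero => exact fun _ => .refl _
    | succ k ih =>
      intro hk
      rw [Function.iterate_succ_apply']
      refine (ih (by omega)).trans _ _ _ (.trans _ (D.glue (f^[k] (x, i))) _
        (.rel _ _ (Or.inl rfl)) (.rel _ _ (Or.inr ⟨?_, rfl⟩)))
      exact Nat.find_min hex (by omega)
  refine ⟨(D.glue (f^[Nat.find hex] (x, i))).2, ?_, ?_⟩
  · have e : (x, (D.glue (f^[Nat.find hex] (x, i))).2) = D.glue (f^[Nat.find hex] (x, i)) :=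
      Prod.ext (Nat.find_spec hex).symm rfl
    rw [e, h.glue_mem, hmem]
  · have e : (x, (D.glue (f^[Nat.find hex] (x, i))).2) = D.glue (f^[Nat.find hex] (x, i)) :=
      Prod.ext (Nat.find_spec hex).symm rfl
    rw [e]
    exact (hpath _ le_rfl).trans _ _ _ (.rel _ _ (Or.inl rfl))

/-! ### Merged shaded regions and their boundary circles. -/

/-- Two corners touch: along an arc, or through the channel at one of the nodes in `A`. -/
def Touch (D : Diagram) (σ : Set D.Flag) (U A : Set D.Node) (q r : D.Flag) : Prop :=
  r = D.across q ∨ q.1 ∈ A ∧ r = (q.1, q.2 + 2) ∧ (q ∈ σ ↔ q.1 ∈ U)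

theorem eqvGen_touch_mono {U U' A A' : Set D.Node} (hA : A ⊆ A')
    (hU : ∀ x ∈ A, x ∈ U ↔ x ∈ U') {q r : D.Flag} (hqr : EqvGen (D.Touch σ U A) q r) :
    EqvGen (D.Touch σ U' A') q r := by
  refine eqvGen_lift id ?_ hqr
  rintro q r (h | ⟨h1, h2, h3⟩)
  · exact .rel _ _ (Or.inl h)
  · exact .rel _ _ <| Or.inr ⟨hA h1, h2, h3.trans (hU _ h1)⟩

open Classical in
/-- The shaded one of the two corners beside a port. -/
noncomputable def shadedSide (D : Diagram) (σ : Set D.Flag) (p : D.Flag) : D.Flag :=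
  if p ∈ σ then p else (p.1, p.2 - 1)

theorem shadedSide_of_mem {p : D.Flag} (hp : p ∈ σ) : D.shadedSide σ p = p := if_pos hp

theorem IsCheckerboard.shadedSide_mem (h : D.IsCheckerboard σ) (p : D.Flag) :
    D.shadedSide σ p ∈ σ := by
  unfold shadedSide
  split_ifs with hp
  · exact hp
  · exact (h.mem_pred _ _).2 hp

theorem across_glue (D : Diagram) (p : D.Flag) : D.across (D.glue p) = (p.1, p.2 - 1) := by
  simp only [across, D.glue_glue]

/-- The shaded side of a state circle stays in one region. -/
theorem IsCheckerboard.shadedSide_circle (h : D.IsCheckerboard σ) {U A : Set D.Node}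
    (hU : U ⊆ A) {p q : D.Flag} (hpq : EqvGen (D.CircleStep σ U Set.univ) p q) :
    EqvGen (D.Touch σ U A) (D.shadedSide σ p) (D.shadedSide σ q) := by
  induction hpq with
  | refl => exact .refl _
  | symm _ _ _ ih => exact ih.symm
  | trans _ _ _ _ _ h1 h2 => exact h1.trans _ _ _ h2
  | rel p q hpq =>
    rcases hpq with rfl | ⟨-, rfl⟩
    · unfold shadedSide
      have h1 := h.glue_mem p
      by_cases hp : p ∈ σ
      · rw [if_pos hp, if_neg (by tauto)]
        exact .rel _ _ (Or.inl rfl)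
      · rw [if_neg hp, if_pos (by tauto), ← D.across_glue p]
        exact .symm _ _ (.rel _ _ (Or.inl rfl))
    · unfold shadedSide
      have h1 := h.turn_mem U p
      have h2 := turn_fst (σ := σ) U p
      obtain ⟨x, i⟩ := p
      have e1 := (by decide : ∀ i : Fin 4, i - 1 - 1 = i + 2) i
      have e2 := (by decide : ∀ i : Fin 4, i - 1 = i + 1 + 2) i
      by_cases hp : (x, i) ∈ σ
      · rw [if_pos hp, if_neg (by tauto)]
        by_cases hx : x ∈ U
        · simp only [turn, hp, hx, not_true, iff_false, if_false]
          rw [e1]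
          exact .rel _ _ (Or.inr ⟨hU hx, rfl, by simp [hp, hx]⟩)
        · simp only [turn, hp, hx, not_false_eq_true, if_true, add_sub_cancel_right]
          exact .refl _
      · rw [if_neg hp, if_pos (by tauto)]
        by_cases hx : x ∈ U
        · simp only [turn, hp, hx, not_true, if_true]
          refine .symm _ _ (.rel _ _ (Or.inr ⟨hU hx, ?_, by simp [h.mem_succ, hp, hx]⟩))
          simp only [e2]
        · simp only [turn, hp, hx, not_false_eq_true, iff_true, if_false]
          exact .refl _

/-- Ports on one side of the same shaded region lie on one state circle. -/
def BoundsOneCircle (D : Diagram) (σ : Set D.Flag) (U : Set D.Node) : Prop :=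
  ∀ p q, EqvGen (D.Touch σ U U) (D.shadedSide σ p) (D.shadedSide σ q) →
    EqvGen (D.CircleStep σ U Set.univ) p q

theorem IsCheckerboard.eqvGen_touch_mem (h : D.IsCheckerboard σ) {U A : Set D.Node}
    {q r : D.Flag} (hqr : EqvGen (D.Touch σ U A) q r) : q ∈ σ ↔ r ∈ σ := by
  induction hqr with
  | refl => rfl
  | symm _ _ _ ih => exact ih.symm
  | trans _ _ _ _ _ h1 h2 => exact h1.trans h2
  | rel q r hqr =>
    rcases hqr with rfl | ⟨-, rfl, -⟩
    · exact (h.2 q).symm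
    · exact (h.mem_opp _ _).symm

/-- For `U` empty every node cuts off its shaded corners, so each circle is the boundary walk of a
shaded face. -/
theorem IsCheckerboard.boundsOneCircle_empty (h : D.IsCheckerboard σ) :
    D.BoundsOneCircle σ ∅ := by
  have hturn : ∀ x i, (x, i) ∉ σ → EqvGen (D.CircleStep σ ∅ Set.univ) (x, i) (x, i - 1) :=
    fun x i hi => .rel _ _ (Or.inr ⟨trivial, by simp [turn, hi]⟩)
  have key : ∀ q r, EqvGen (D.Touch σ ∅ ∅) q r → q ∈ σ →
      EqvGen (D.CircleStep σ ∅ Set.univ) q r := by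
    intro q r hqr
    induction hqr with
    | refl => exact fun _ => .refl _
    | symm q r hqr ih => exact fun hr => (ih ((h.eqvGen_touch_mem hqr).2 hr)).symm
    | trans q r t hqr _ h1 h2 =>
      exact fun hq => (h1 hq).trans _ _ _ (h2 ((h.eqvGen_touch_mem hqr).1 hq))
    | rel q r hqr =>
      intro hq
      rcases hqr with rfl | ⟨hf, -⟩
      · refine (EqvGen.rel _ (D.glue q) (Or.inl rfl)).trans _ _ _ (hturn _ _ ?_)
        change D.glue q ∉ σ
        rw [h.glue_mem]; exact fun h' => h' hq
      · exact hf.elim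
  have hside : ∀ p, EqvGen (D.CircleStep σ ∅ Set.univ) p (D.shadedSide σ p) := by
    intro p
    unfold shadedSide
    split_ifs with hp
    · exact .refl _
    · exact hturn _ _ hp
  exact fun p q hpq =>
    (hside p).trans _ _ _ ((key _ _ hpq (h.shadedSide_mem p)).trans _ _ _ (hside q).symm)

/-- Merging two different shaded regions merges their boundary circles. -/
theorem IsCheckerboard.boundsOneCircle_insert (h : D.IsCheckerboard σ) {U : Set D.Node}
    (hU : D.BoundsOneCircle σ U) {x : D.Node} {i : Fin 4} (hi : (x, i) ∈ σ)
    (hne : ¬ EqvGen (D.Touch σ U U) (x, i) (x, i + 2)) :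
    D.BoundsOneCircle σ (insert x U) := by
  set C := EqvGen (D.CircleStep σ (insert x U) Set.univ) with hC
  have hturn : ∀ p : D.Flag, p.1 ≠ x → D.turn σ (insert x U) p = D.turn σ U p := by
    intro p hp
    have : p.1 ∈ insert x U ↔ p.1 ∈ U := by simp [hp]
    unfold turn; split_ifs <;> first | rfl | tauto
  have hlift : ∀ {p q}, EqvGen (D.CircleStep σ U {x}ᶜ) p q → C p q := by
    intro p q hpq
    refine eqvGen_lift id ?_ hpq
    rintro p q (h1 | ⟨h1, h2⟩)
    · exact .rel _ _ (Or.inl h1)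
    · exact .rel _ _ <| Or.inr ⟨trivial, h2.trans (hturn p h1).symm⟩
  have hdrop : ∀ {p q}, EqvGen (D.CircleStep σ U {x}ᶜ) p q →
      EqvGen (D.CircleStep σ U Set.univ) p q := by
    intro p q hpq
    refine eqvGen_lift id ?_ hpq
    rintro p q (h1 | ⟨h1, h2⟩)
    · exact .rel _ _ (Or.inl h1)
    · exact .rel _ _ <| Or.inr ⟨trivial, h2⟩
  -- A strand leaving `x` at `j` returns at a neighbouring port. If that were `j - 1`, its shaded
  -- side would connect corner `j` with corner `j + 2`, which lie in different regions. So it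
  -- returns at `j + 1`, outside `x`, and the path survives the change at `x`.
  have hloop : ∀ j, (x, j) ∈ σ → ¬ EqvGen (D.Touch σ U U) (x, j) (x, j + 2) →
      C (x, j) (x, j + 1) := by
    intro j hj hjne
    obtain ⟨k, hk, hjk⟩ := h.exists_return U x j
    have hkσ : (x, k) ∉ σ := by tauto
    have : k = j + 1 ∨ k = j - 1 := by
      have h1 := h.mem_opp x j
      have c1 : k ≠ j := by rintro rfl; tauto
      have c2 : k ≠ j + 2 := by rintro rfl; tauto
      clear * - c1 c2
      revert k j; decide
    rcases this with rfl | rfl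
    · exact hlift hjk
    · have h2 := h.shadedSide_circle subset_rfl (hdrop hjk)
      rw [shadedSide_of_mem hj, shadedSide, if_neg hkσ] at h2
      have e := (by decide : ∀ j : Fin 4, j - 1 - 1 = j + 2) j
      simp only [e] at h2
      exact (hjne h2).elim
  have hi2 : (x, i + 2) ∈ σ := (h.mem_opp x i).2 hi
  have e4 := (by decide : ∀ i : Fin 4, i + 2 + 2 = i) i
  have l1 : C (x, i) (x, i + 1) := hloop i hi hne
  have l2 : C (x, i + 2) (x, i + 2 + 1) := hloop (i + 2) hi2 (by
    rw [e4]; exact fun h' => hne h'.symm)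
  -- The new arc from `i` to `i - 1 = i + 2 + 1` links the two loops, and all four ports of `x` lie
  -- on one circle.
  have l3 : C (x, i) (x, i + 2) := by
    refine .trans _ _ _ (.rel _ _ (Or.inr ⟨trivial, ?_⟩)) l2.symm
    have := (by decide : ∀ i : Fin 4, i - 1 = i + 2 + 1) i
    simp [turn, hi, this]
  have hall : ∀ j, C (x, i) (x, j) := by
    intro j
    have := (by decide : ∀ i j : Fin 4, j = i ∨ j = i + 1 ∨ j = i + 2 ∨ j = i + 2 + 1) i j
    rcases this with rfl | rfl | rfl | rfl
    · exact .refl _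
    · exact l1
    · exact l3
    · exact l3.trans _ _ _ l2
  have hCU : ∀ {p q}, EqvGen (D.CircleStep σ U Set.univ) p q → C p q := by
    intro p q hpq
    induction hpq with
    | refl => exact .refl _
    | symm _ _ _ ih => exact ih.symm
    | trans _ _ _ _ _ h1 h2 => exact h1.trans _ _ _ h2
    | rel p q hpq =>
      rcases hpq with rfl | ⟨-, rfl⟩
      · exact .rel _ _ (Or.inl rfl)
      · by_cases hp : p.1 = x
        · have hq := turn_fst (σ := σ) U p
          have e1 : p = (x, p.2) := Prod.ext hp rfl
          have e2 : D.turn σ U p = (x, (D.turn σ U p).2) := Prod.ext (hq.trans hp) rfl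
          rw [e2]; nth_rw 1 [e1]
          exact (hall _).symm.trans _ _ _ (hall _)
        · exact .rel _ _ (Or.inr ⟨trivial, (hturn p hp).symm⟩)
  suffices H : ∀ q r, EqvGen (D.Touch σ (insert x U) (insert x U)) q r → q ∈ σ →
      ∀ p p', D.shadedSide σ p = q → D.shadedSide σ p' = r → C p p' by
    intro p q hpq
    exact H _ _ hpq (h.shadedSide_mem p) p q rfl rfl
  intro q r hqr
  induction hqr with
  | refl q =>
    intro _ p p' h1 h2
    exact hCU (hU p p' (by rw [h1, h2]; exact .refl _))
  | symm q r hqr ih =>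
    intro hr p p' h1 h2
    exact (ih ((h.eqvGen_touch_mem hqr).2 hr) p' p h2 h1).symm
  | trans q r t hqr _ ih1 ih2 =>
    intro hq p p' h1 h2
    have hr := (h.eqvGen_touch_mem hqr).1 hq
    exact (ih1 hq p r h1 (shadedSide_of_mem hr)).trans _ _ _
      (ih2 hr r p' (shadedSide_of_mem hr) h2)
  | rel q r hqr =>
    intro hq p p' h1 h2
    by_cases hqx : r = D.across q ∨ q.1 ≠ x
    · refine hCU (hU p p' ?_)
      rw [h1, h2]
      refine .rel _ _ ?_
      rcases hqr with h3 | ⟨h3, h4, -⟩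
      · exact Or.inl h3
      · rcases hqx with h5 | h5
        · exact Or.inl h5
        · have : q.1 ∈ U := h3.resolve_left h5
          exact Or.inr ⟨this, h4, by simp [hq, this]⟩
    · push Not at hqx
      have h3 := hqr.resolve_left hqx.1
      have hr : r ∈ σ := (h.eqvGen_touch_mem (.rel _ _ hqr)).1 hq
      have c1 : C p q := hCU (hU p q (by rw [h1, shadedSide_of_mem hq]; exact .refl _))
      have c2 : C r p' := hCU (hU r p' (by rw [h2, shadedSide_of_mem hr]; exact .refl _))
      refine c1.trans _ _ _ (.trans _ _ _ ?_ c2)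
      obtain ⟨y, j⟩ := q
      obtain ⟨rfl⟩ : y = x := hqx.2
      rw [h3.2.1]
      exact (hall _).symm.trans _ _ _ (hall _)

end Diagram

/-! ### Counting faces: what Euler's formula says about one-circle states. -/

namespace Diagram

open Relation

/-- Adding one pair to a relation merges at most two classes. -/
theorem card_quot_le_succ {X : Type*} [Finite X] {r r' : X → X → Prop} (a b : X)
    (h : ∀ x y, r' x y → r x y ∨ (x = a ∧ y = b) ∨ (x = b ∧ y = a)) :
    Nat.card (Quot r) ≤ Nat.card (Quot r') + 1 := by
  classical
  -- `φ` redirects the class of `b` to the class of `a`. At most one class is lost, and `none`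
  -- stands for it.
  let φ : X → Quot r := fun z => if Quot.mk r z = Quot.mk r b then Quot.mk r a else Quot.mk r z
  have hφ : φ a = φ b := by simp only [φ, if_true, ite_self]
  have hr : ∀ x y, r' x y → φ x = φ y := by
    intro x y hxy
    rcases h x y hxy with h1 | ⟨rfl, rfl⟩ | ⟨rfl, rfl⟩
    · simp only [φ, Quot.sound h1]
    · exact hφ
    · exact hφ.symm
  rw [← Finite.card_option]
  refine Nat.card_le_card_of_surjective
    (fun o : Option (Quot r') => o.elim (Quot.mk r b) (Quot.lift φ hr)) ?_
  rintro ⟨z⟩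
  by_cases hz : Quot.mk r z = Quot.mk r b
  · exact ⟨none, hz.symm⟩
  · exact ⟨some (Quot.mk r' z), if_neg hz⟩

variable {D : Diagram} {σ : Set D.Flag}

/-- The number of regions of the projection in which every node is a crossing. -/
noncomputable def faceCount (D : Diagram) : ℕ :=
  Nat.card (Quot fun q r : D.Flag => r = D.across q)

theorem faceCount_eq (σ : Set D.Flag) (U : Set D.Node) :
    D.faceCount = Nat.card (Quot (D.Touch σ U ∅)) := by
  have : (fun q r : D.Flag => r = D.across q) = D.Touch σ U ∅ := by
    ext q r; simp [Touch]
  rw [faceCount, this]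

/-- The channels at `A` are opened one at a time, and each merges at most two classes of corners. -/
theorem IsCheckerboard.faceCount_le (h : D.IsCheckerboard σ) (U : Set D.Node) (A : Finset D.Node) :
    D.faceCount ≤ Nat.card (Quot (D.Touch σ U A)) + A.card := by
  classical
  have := D.finite
  induction A using Finset.induction_on with
  | empty => simp [faceCount_eq σ U]
  | insert x A hx ih =>
    rw [Finset.card_insert_of_notMem hx]
    obtain ⟨i, hi⟩ : ∃ i, (x, i) ∈ σ ↔ x ∈ U := by
      have := h.mem_succ x 0
      by_cases hc : (x, (0 : Fin 4)) ∈ σ ↔ x ∈ U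
      · exact ⟨0, hc⟩
      · exact ⟨0 + 1, by tauto⟩
    have := card_quot_le_succ (r := D.Touch σ U A) (r' := D.Touch σ U ↑(insert x A))
      (x, i) (x, i + 2) (by
        rintro ⟨y, j⟩ r (h1 | ⟨h1, rfl, h2⟩)
        · exact Or.inl (Or.inl h1)
        · rw [Finset.coe_insert] at h1
          rcases h1 with h1 | h1
          · right
            dsimp only at h1 h2
            subst h1
            have c1 := h.mem_succ y i
            have c2 := h.mem_pred y i
            have : j = i ∨ j = i + 2 := by
              have d1 : j ≠ i + 1 := by rintro rfl; tauto
              have d2 : j ≠ i - 1 := by rintro rfl; tauto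
              clear * - d1 d2
              revert i j; decide
            rcases this with rfl | rfl
            · exact Or.inl ⟨rfl, rfl⟩
            · exact Or.inr ⟨rfl, Prod.ext rfl ((by decide : ∀ i : Fin 4, i + 2 + 2 = i) i)⟩
          · exact Or.inl (Or.inr ⟨h1, rfl, h2⟩))
    omega

theorem touch_compl (U A : Set D.Node) : D.Touch σᶜ Uᶜ A = D.Touch σ U A := by
  ext q r
  simp only [Touch, Set.mem_compl_iff, not_iff_not]

theorem turn_compl (U : Set D.Node) : D.turn σᶜ Uᶜ = D.turn σ U := by
  ext1 p
  unfold turn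
  have h1 : p ∈ σᶜ ↔ p ∉ σ := Iff.rfl
  have h2 : p.1 ∈ Uᶜ ↔ p.1 ∉ U := Iff.rfl
  split_ifs <;> first | rfl | tauto

theorem circleStep_compl (U A : Set D.Node) : D.CircleStep σᶜ Uᶜ A = D.CircleStep σ U A := by
  ext p q
  simp only [CircleStep, turn_compl]

/-- The state given by `U` consists of a single circle. -/
def OneCircle (D : Diagram) (σ : Set D.Flag) (U : Set D.Node) : Prop :=
  ∀ p q, EqvGen (D.CircleStep σ U Set.univ) p q

theorem oneCircle_compl (U : Set D.Node) : D.OneCircle σᶜ Uᶜ ↔ D.OneCircle σ U := by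
  unfold OneCircle; rw [circleStep_compl]

theorem OneCircle.touch {U A : Set D.Node} (hU : D.OneCircle σ U) (h : D.IsCheckerboard σ)
    (hA : U ⊆ A) {q r : D.Flag} (hq : q ∈ σ) (hr : r ∈ σ) : EqvGen (D.Touch σ U A) q r := by
  have := h.shadedSide_circle hA (hU q r)
  rwa [shadedSide_of_mem hq, shadedSide_of_mem hr] at this

/-- The circle has all shaded corners on one side and all unshaded ones on the other. Complementing
both the colouring and the state keeps the circles and reduces the unshaded case to the shaded one.
-/
theorem OneCircle.touch_univ {U : Set D.Node} (hU : D.OneCircle σ U) (h : D.IsCheckerboard σ)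
    {q r : D.Flag} (hqr : q ∈ σ ↔ r ∈ σ) : EqvGen (D.Touch σ U Set.univ) q r := by
  by_cases hq : q ∈ σ
  · exact hU.touch h (Set.subset_univ _) hq (hqr.1 hq)
  · have := ((oneCircle_compl U).2 hU).touch h.compl (Set.subset_univ _) hq (mt hqr.2 hq)
    rwa [touch_compl] at this

/-- In a state with one circle no channel is superfluous. -/
theorem OneCircle.not_touch {U : Set D.Node} (hU : D.OneCircle σ U) (h : D.IsCheckerboard σ)
    (hF : Nat.card D.Node + 2 ≤ D.faceCount) {x : D.Node} {i : Fin 4}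
    (hxi : (x, i) ∈ σ ↔ x ∈ U) : ¬ EqvGen (D.Touch σ U {x}ᶜ) (x, i) (x, i + 2) := by
  classical
  intro hc
  have := D.finite
  have := Fintype.ofFinite D.Node
  -- All `n` channels together leave at most two classes, one for each colour. Were the one at `x`
  -- superfluous, `n - 1` channels would do the same, and there could be at most `n + 1` faces.
  have h1 : Nat.card (Quot (D.Touch σ U Set.univ)) ≤ 2 := by
    have e : Nat.card Bool = 2 := by simp
    rw [← e]
    refine Nat.card_le_card_of_surjective
      (fun b : Bool => Quot.mk _ (if b then (x, i) else (x, i + 1))) ?_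
    rintro ⟨q⟩
    have hs := h.mem_succ x i
    by_cases hq : q ∈ σ ↔ (x, i) ∈ σ
    · exact ⟨true, Quot.eqvGen_sound (hU.touch_univ h hq.symm)⟩
    · exact ⟨false, Quot.eqvGen_sound (hU.touch_univ h (by
        simp only [Bool.false_eq_true, if_false]; tauto))⟩
  have h2 : Nat.card (Quot (D.Touch σ U {x}ᶜ)) ≤ Nat.card (Quot (D.Touch σ U Set.univ)) := by
    refine Nat.card_le_card_of_surjective (Quot.lift (Quot.mk _) ?_) ?_
    · rintro ⟨y, j⟩ r (h3 | ⟨-, rfl, h3⟩)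
      · exact Quot.sound (Or.inl h3)
      · by_cases hy : y = x
        · subst hy
          dsimp only at h3
          have c1 := h.mem_succ y i
          have c2 := h.mem_pred y i
          have : j = i ∨ j = i + 2 := by
            have d1 : j ≠ i + 1 := by rintro rfl; tauto
            have d2 : j ≠ i - 1 := by rintro rfl; tauto
            clear * - d1 d2
            revert i j; decide
          rcases this with rfl | rfl
          · exact Quot.eqvGen_sound hc
          · refine (Quot.eqvGen_sound hc.symm).trans (congrArg _ (Prod.ext rfl ?_))
            exact ((by decide : ∀ i : Fin 4, i = i + 2 + 2) i)
        · exact Quot.sound (Or.inr ⟨hy, rfl, h3⟩)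
    · rintro ⟨q⟩
      exact ⟨Quot.mk _ q, rfl⟩
  have h3 := h.faceCount_le U (Finset.univ.erase x)
  rw [Finset.coe_erase, Finset.coe_univ, ← Set.compl_eq_univ_sdiff,
    Finset.card_erase_of_mem (Finset.mem_univ x), Finset.card_univ, ← Nat.card_eq_fintype_card] at h3
  have : 0 < Nat.card D.Node := Nat.card_pos_iff.2 ⟨⟨x⟩, inferInstance⟩
  omega

/-- The channels at the nodes of `U` join shaded corners only. They merge all of these into one
class and leave the unshaded faces alone. -/
theorem OneCircle.faceCount_le {U : Set D.Node} (hU : D.OneCircle σ U) (h : D.IsCheckerboard σ)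
    {q₀ : D.Flag} (hq₀ : q₀ ∈ σ) :
    D.faceCount ≤
      {f : Quot fun q r : D.Flag => r = D.across q | ∃ q ∉ σ, Quot.mk _ q = f}.ncard + 1 +
        U.ncard := by
  classical
  have := D.finite
  have h1 := h.faceCount_le U U.toFinite.toFinset
  rw [Set.Finite.coe_toFinset, ← Set.ncard_eq_toFinset_card U] at h1
  refine h1.trans (Nat.add_le_add_right ?_ _)
  rw [← Nat.card_coe_set_eq, ← Finite.card_option]
  refine Nat.card_le_card_of_surjective (fun o => o.elim (Quot.mk _ q₀) fun f =>
    Quot.lift (Quot.mk _) (fun q r hqr => Quot.sound (Or.inl hqr)) f.1) ?_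
  rintro ⟨q⟩
  by_cases hq : q ∈ σ
  · exact ⟨none, Quot.eqvGen_sound (hU.touch h subset_rfl hq₀ hq)⟩
  · exact ⟨some ⟨Quot.mk _ q, q, hq, rfl⟩, rfl⟩

/-- All states with one circle merge equally many shaded corners. -/
theorem OneCircle.ncard_eq {U U' : Set D.Node} (hU : D.OneCircle σ U) (hU' : D.OneCircle σ U')
    (h : D.IsCheckerboard σ) (hF : Nat.card D.Node + 2 ≤ D.faceCount) :
    U.ncard = U'.ncard := by
  have := D.finite
  rcases isEmpty_or_nonempty D.Node with hE | ⟨⟨x⟩⟩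
  · rw [Set.eq_empty_of_isEmpty U, Set.eq_empty_of_isEmpty U']
  obtain ⟨q, r, hq, hr⟩ : ∃ q r : D.Flag, q ∈ σ ∧ r ∉ σ := by
    have := h.mem_succ x 0
    by_cases hc : (x, (0 : Fin 4)) ∈ σ
    · exact ⟨_, (x, 0 + 1), hc, by tauto⟩
    · exact ⟨(x, 0 + 1), _, this.2 hc, hc⟩
  set s : Set (Quot fun q r : D.Flag => r = D.across q) := {f | ∃ q ∉ σ, Quot.mk _ q = f}
  set t : Set (Quot fun q r : D.Flag => r = D.across q) := {f | ∃ q ∈ σ, Quot.mk _ q = f}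
  have hst : s.ncard + t.ncard ≤ D.faceCount := by
    rw [← Set.ncard_union_eq, faceCount, ← Set.ncard_univ]
    · exact Set.ncard_le_ncard (Set.subset_univ _)
    · rw [Set.disjoint_left]
      rintro _ ⟨a, ha, rfl⟩ ⟨b, hb, hab⟩
      have hab := (Quot.eqvGen_exact hab)
      refine ha ((h.eqvGen_touch_mem (U := ∅) (A := ∅) ?_).1 hb)
      exact eqvGen_lift (s := D.Touch σ ∅ ∅) id (fun _ _ h' => .rel _ _ (Or.inl h')) hab
  -- The bounds for `U` and for its complement in the complementary colouring force `U.ncard =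
  -- t.ncard - 1`, the number of edges of a tree on the shaded faces.
  have key : ∀ U : Set D.Node, D.OneCircle σ U → D.faceCount ≤ s.ncard + 1 + U.ncard ∧
      D.faceCount ≤ t.ncard + 1 + Uᶜ.ncard := by
    intro U hU
    refine ⟨hU.faceCount_le h hq, ?_⟩
    have := ((oneCircle_compl U).2 hU).faceCount_le h.compl hr
    simpa only [Set.mem_compl_iff, not_not] using this
  have a1 := key U hU
  have a2 := key U' hU'
  have b1 := Set.ncard_add_ncard_compl U
  have b2 := Set.ncard_add_ncard_compl U'
  omega

/-! ### Connected diagrams have a state with one circle. -/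

/-- The smoothed nodes at which shaded corners merge. -/
def smoothedMerging (D : Diagram) (σ : Set D.Flag) : Set D.Node :=
  {x | D.elem x = .vert ∧ (x, 0) ∈ σ ∨ D.elem x = .horiz ∧ (x, 1) ∈ σ}

/-- The state `U` does at the smoothed nodes what is drawn there. -/
def Extends (D : Diagram) (σ : Set D.Flag) (U : Set D.Node) : Prop :=
  ∀ x, ¬ (D.elem x).IsCrossing → (x ∈ U ↔ x ∈ D.smoothedMerging σ)

/-- One step along the projection in which the nodes outside `A` are crossings. -/
def PartialStep (D : Diagram) (σ : Set D.Flag) (U A : Set D.Node) (p q : D.Flag) : Prop :=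
  q = D.glue p ∨ p.1 = q.1 ∧ (p.1 ∈ A → q = D.turn σ U p)

/-- One of the two smoothings of a node keeps the projection connected. -/
theorem IsCheckerboard.exists_smoothing (h : D.IsCheckerboard σ) {U A : Set D.Node}
    (hU : ∀ p q, EqvGen (D.PartialStep σ U A) p q) (x : D.Node) :
    ∃ U', (∀ y ≠ x, y ∈ U' ↔ y ∈ U) ∧ ∀ p q, EqvGen (D.PartialStep σ U' (insert x A)) p q := by
  obtain ⟨j, hj, hr⟩ := h.exists_return U x 0
  have hj13 : j = 1 ∨ j = 3 := by
    have h1 := h.mem_opp x 0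
    have c1 : j ≠ 0 := by rintro rfl; tauto
    have c2 : j ≠ 0 + 2 := by rintro rfl; tauto
    clear * - c1 c2
    revert j; decide
  -- `P` selects the smoothing that does not join port `0` to the port `j` at which its strand
  -- returns. The outside strand and the two new arcs then connect all four ports of `x`.
  obtain ⟨P, hP⟩ : ∃ P : Prop, P ↔ ((x, (0 : Fin 4)) ∈ σ ↔ j = 1) := ⟨_, Iff.rfl⟩
  refine ⟨{y | y = x ∧ P ∨ y ≠ x ∧ y ∈ U}, fun y hy => by simp [hy], ?_⟩
  set U' : Set D.Node := {y | y = x ∧ P ∨ y ≠ x ∧ y ∈ U} with hU'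
  have hxU : x ∈ U' ↔ P := by simp [hU']
  have hturn : ∀ p : D.Flag, p.1 ≠ x → D.turn σ U' p = D.turn σ U p := by
    intro p hp
    have : p.1 ∈ U' ↔ p.1 ∈ U := by simp [hU', hp]
    unfold turn; split_ifs <;> first | rfl | tauto
  set R := EqvGen (D.PartialStep σ U' (insert x A)) with hR
  have hstep : ∀ p q : D.Flag, p.1 ≠ x → p.1 = q.1 → (p.1 ∈ A → q = D.turn σ U p) → R p q := by
    intro p q hp h1 h2
    refine .rel _ _ (Or.inr ⟨h1, fun h3 => ?_⟩)
    rw [hturn p hp]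
    exact h2 (h3.resolve_left hp)
  have hret : R (x, 0) (x, j) := by
    refine eqvGen_lift id ?_ hr
    rintro p q (rfl | ⟨h1, rfl⟩)
    · exact .rel _ _ (Or.inl rfl)
    · exact hstep _ _ h1 (turn_fst U p).symm fun _ => rfl
  have hat : ∀ i, R (x, i) (D.turn σ U' (x, i)) := fun i =>
    .rel _ _ (Or.inr ⟨(turn_fst U' _).symm, fun _ => rfl⟩)
  have hall : ∀ i, R (x, 0) (x, i) := by
    have c1 : (x, (1 : Fin 4)) ∈ σ ↔ (x, (0 : Fin 4)) ∉ σ := h.mem_succ x 0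
    have c2 : (x, (2 : Fin 4)) ∈ σ ↔ (x, (0 : Fin 4)) ∈ σ := h.mem_opp x 0
    rcases hj13 with rfl | rfl
    · have hx' : (x, (0 : Fin 4)) ∈ σ ↔ x ∈ U' := by rw [hxU, hP]; simp
      have t0 : D.turn σ U' (x, 0) = (x, 3) := turn_pred (by rw [hx']; exact iff_not_self)
      have t1 : D.turn σ U' (x, 1) = (x, 2) := turn_succ (c1.trans (not_congr hx'))
      have a0 := hat 0
      have a1 := hat 1
      rw [t0] at a0
      rw [t1] at a1
      intro i
      obtain rfl | rfl | rfl | rfl :=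
        (by decide : ∀ i : Fin 4, i = 0 ∨ i = 1 ∨ i = 2 ∨ i = 3) i
      exacts [.refl _, hret, hret.trans _ _ _ a1, a0]
    · have hx' : (x, (0 : Fin 4)) ∈ σ ↔ x ∉ U' := by rw [hxU, hP]; simp
      have t0 : D.turn σ U' (x, 0) = (x, 1) := turn_succ hx'
      have t2 : D.turn σ U' (x, 2) = (x, 3) := turn_succ (c2.trans hx')
      have a0 := hat 0
      have a2 := hat 2
      rw [t0] at a0
      rw [t2] at a2
      intro i
      obtain rfl | rfl | rfl | rfl :=
        (by decide : ∀ i : Fin 4, i = 0 ∨ i = 1 ∨ i = 2 ∨ i = 3) i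
      exacts [.refl _, a0, hret.trans _ _ _ a2.symm, hret]
  have hto : ∀ p, R (x, 0) p := by
    have inv : ∀ p q, EqvGen (D.PartialStep σ U A) p q → (R (x, 0) p ↔ R (x, 0) q) := by
      intro p q hpq
      induction hpq with
      | refl => rfl
      | symm _ _ _ ih => exact ih.symm
      | trans _ _ _ _ _ h1 h2 => exact h1.trans h2
      | rel p q hpq =>
        have : p.1 = x ∧ q.1 = x ∨ R p q := by
          rcases hpq with rfl | ⟨h1, h2⟩
          · exact Or.inr (.rel _ _ (Or.inl rfl))
          · by_cases hp : p.1 = x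
            · exact Or.inl ⟨hp, h1 ▸ hp⟩
            · exact Or.inr (hstep p q hp h1 h2)
        rcases this with ⟨h1, h2⟩ | hpq
        · have e1 : p = (x, p.2) := Prod.ext h1 rfl
          have e2 : q = (x, q.2) := Prod.ext h2 rfl
          rw [e1, e2]
          exact ⟨fun _ => hall _, fun _ => hall _⟩
        · exact ⟨fun h1 => h1.trans _ _ _ hpq, fun h1 => h1.trans _ _ _ hpq.symm⟩
    exact fun p => (inv _ _ (hU (x, 0) p)).1 (.refl _)
  exact fun p q => (hto p).symm.trans _ _ _ (hto q)

theorem IsCheckerboard.turn_of_joined (h : D.IsCheckerboard σ) {U : Set D.Node}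
    (hU : D.Extends σ U) {p q : D.Flag} (hp : ¬ (D.elem p.1).IsCrossing) (hpq : p.1 = q.1)
    (hj : (D.elem p.1).PortsJoined p.2 q.2) : q = p ∨ q = D.turn σ U p := by
  obtain ⟨x, i⟩ := p
  obtain ⟨y, j⟩ := q
  obtain rfl : x = y := hpq
  have hx := hU x hp
  dsimp only at hj hp
  have c1 : (x, (1 : Fin 4)) ∈ σ ↔ (x, (0 : Fin 4)) ∉ σ := h.mem_succ x 0
  have c2 : (x, (2 : Fin 4)) ∈ σ ↔ (x, (0 : Fin 4)) ∈ σ := h.mem_opp x 0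
  have c3 : (x, (3 : Fin 4)) ∈ σ ↔ (x, (1 : Fin 4)) ∈ σ := h.mem_opp x 1
  cases he : D.elem x with
  | pos => exact (hp (Or.inl he)).elim
  | neg => exact (hp (Or.inr he)).elim
  | vert =>
    have hx' : x ∈ U ↔ (x, (0 : Fin 4)) ∈ σ := by rw [hx]; simp [smoothedMerging, he]
    rw [he] at hj
    rcases hj with rfl | rfl
    · exact Or.inl rfl
    · right
      fin_cases i <;> simp [turn, hx', c1, c2, c3]; rfl
  | horiz =>
    have hx' : x ∈ U ↔ (x, (1 : Fin 4)) ∈ σ := by rw [hx]; simp [smoothedMerging, he]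
    rw [he] at hj
    rcases hj with rfl | rfl
    · exact Or.inl rfl
    · right
      fin_cases i <;> simp [turn, hx', c1, c2, c3]

/-- The crossings are smoothed one after another so that the projection stays connected. When none
is left, the projection consists of disjoint circles, hence of one. -/
theorem IsCheckerboard.exists_oneCircle (h : D.IsCheckerboard σ) (hD : D.IsConnected) :
    ∃ U, D.Extends σ U ∧ D.OneCircle σ U := by
  classical
  have := D.finite
  have key : ∀ T : Finset D.Node, (∀ x ∈ T, (D.elem x).IsCrossing) → ∃ U, D.Extends σ U ∧
      ∀ p q, EqvGen (D.PartialStep σ U ({x | ¬ (D.elem x).IsCrossing} ∪ T)) p q := by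
    intro T
    induction T using Finset.induction_on with
    | empty =>
      intro _
      have hE : D.Extends σ (D.smoothedMerging σ) := fun _ _ => Iff.rfl
      refine ⟨D.smoothedMerging σ, hE, fun p q => ?_⟩
      induction hD p q with
      | refl => exact .refl _
      | @tail b c _ hbc ih =>
        refine ih.trans _ _ _ ?_
        rcases hbc with rfl | ⟨h1, h2⟩
        · exact .rel _ _ (Or.inl rfl)
        · by_cases hb : (D.elem b.1).IsCrossing
          · exact .rel _ _ (Or.inr ⟨h1, fun h3 => (by simp [hb] at h3)⟩)
          · rcases h.turn_of_joined hE hb h1 h2 with rfl | h3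
            · exact .refl _
            · exact .rel _ _ (Or.inr ⟨h1, fun _ => h3⟩)
    | insert x T hx ih =>
      intro hT
      obtain ⟨U, hE, hU⟩ := ih fun y hy => hT y (Finset.mem_insert_of_mem hy)
      have hxc := hT x (Finset.mem_insert_self _ _)
      obtain ⟨U', h1, h2⟩ := h.exists_smoothing hU x
      refine ⟨U', fun y hy => ?_, ?_⟩
      · rw [h1 y (by rintro rfl; exact hy hxc)]
        exact hE y hy
      · rwa [Finset.coe_insert, Set.union_insert]
  have := Fintype.ofFinite D.Node
  obtain ⟨U, hE, hU⟩ := key (Finset.univ.filter fun x => (D.elem x).IsCrossing) (by simp)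
  refine ⟨U, hE, fun p q => eqvGen_lift id ?_ (hU p q)⟩
  rintro p q (h1 | ⟨-, h1⟩)
  · exact .rel _ _ (Or.inl h1)
  · exact .rel _ _ (Or.inr ⟨trivial, h1 (by simp [em'])⟩)

end Diagram

/-! ### Spanning trees of the Tait graph and one-circle states. -/

namespace Diagram

open Relation

variable {D : Diagram} {σ : Set D.Flag}

theorem not_isCrossing_of_mem {x : D.Node} (hx : x ∈ D.smoothedMerging σ) :
    ¬ (D.elem x).IsCrossing := by
  rintro (h | h) <;> simp [smoothedMerging, h] at hx

theorem extends_union {S : Set D.Node} (hS : ∀ x ∈ S, (D.elem x).IsCrossing) :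
    D.Extends σ (S ∪ D.smoothedMerging σ) :=
  fun x hx => ⟨fun h => h.resolve_left fun h' => hx (hS x h'), Or.inr⟩

theorem IsCheckerboard.touch_of_sameRegion (h : D.IsCheckerboard σ) {U A : Set D.Node}
    (hU : D.Extends σ U) (hA : ∀ x, ¬ (D.elem x).IsCrossing → x ∈ A) {q r : D.Flag}
    (hqr : D.SameRegion q r) : D.Touch σ U A q r := by
  rcases hqr with h1 | ⟨h1, h2⟩
  · exact Or.inl h1
  · obtain ⟨x, i⟩ := q
    obtain ⟨y, j⟩ := r
    obtain rfl : x = y := h1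
    dsimp only at h2
    have c1 : (x, (1 : Fin 4)) ∈ σ ↔ (x, (0 : Fin 4)) ∉ σ := h.mem_succ x 0
    cases he : D.elem x with
    | pos => rw [he] at h2; exact h2.elim
    | neg => rw [he] at h2; exact h2.elim
    | vert =>
      have hx : ¬ (D.elem x).IsCrossing := by simp [Elem.IsCrossing, he]
      rw [he] at h2
      obtain ⟨rfl, rfl⟩ := h2
      exact Or.inr ⟨hA x hx, rfl, by dsimp only; rw [hU x hx]; simp [smoothedMerging, he]⟩
    | horiz =>
      have hx : ¬ (D.elem x).IsCrossing := by simp [Elem.IsCrossing, he]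
      rw [he] at h2
      obtain ⟨rfl, rfl⟩ := h2
      exact Or.inr ⟨hA x hx, rfl, by dsimp only; rw [hU x hx]; simp [smoothedMerging, he]⟩

/-- A chain of edges of the Tait graph is a chain of channels. -/
theorem IsCheckerboard.touch_of_links (h : D.IsCheckerboard σ) {U A S : Set D.Node}
    (hU : D.Extends σ U) (hA : ∀ x, ¬ (D.elem x).IsCrossing → x ∈ A) (hSA : S ⊆ A) (hSU : S ⊆ U)
    {q r : D.Flag}
    (hqr : ReflTransGen (fun a b => ∃ e ∈ S, (D.taitGraph σ).IsLink e a b) (D.region q)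
      (D.region r)) : EqvGen (D.Touch σ U A) q r := by
  let F : D.Region → Quot (D.Touch σ U A) :=
    Quot.lift (Quot.mk _) fun _ _ hab => Quot.sound (h.touch_of_sameRegion hU hA hab)
  have : ∀ a b, ReflTransGen (fun a b => ∃ e ∈ S, (D.taitGraph σ).IsLink e a b) a b →
      F a = F b := by
    intro a b hab
    induction hab with
    | refl => rfl
    | tail _ hbc ih =>
      obtain ⟨e, he, -, i, h1, -, -, rfl, rfl⟩ := hbc
      exact ih.trans (Quot.sound (Or.inr ⟨hSA he, rfl, by simp [h1, hSU he]⟩))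
  exact Quot.eqvGen_exact (this _ _ hqr)

theorem IsCheckerboard.isLink (h : D.IsCheckerboard σ) {x : D.Node}
    (hx : (D.elem x).IsCrossing) {i : Fin 4} (hi : (x, i) ∈ σ) :
    (D.taitGraph σ).IsLink x (D.region (x, i)) (D.region (x, i + 2)) := by
  refine ⟨hx, i, hi, (h.mem_opp x i).2 hi, fun k hk => ?_, rfl, rfl⟩
  have c1 : k ≠ i + 1 := by rintro rfl; exact (h.mem_succ x i).1 hk hi
  have c2 : k ≠ i - 1 := by rintro rfl; exact (h.mem_pred x i).1 hk hi
  clear * - c1 c2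
  revert i k; decide

/-- A chain of channels between shaded corners is a chain of edges of the Tait graph. -/
theorem IsCheckerboard.links_of_touch (h : D.IsCheckerboard σ) {U A S : Set D.Node}
    (hU : D.Extends σ U) (hS : ∀ x ∈ A, x ∈ U → (D.elem x).IsCrossing → x ∈ S)
    {q r : D.Flag} (hqr : EqvGen (D.Touch σ U A) q r) (hq : q ∈ σ) :
    ReflTransGen (fun a b => ∃ e ∈ S, (D.taitGraph σ).IsLink e a b) (D.region q)
      (D.region r) := by
  have hsymm : Std.Symm (fun a b => ∃ e ∈ S, (D.taitGraph σ).IsLink e a b) :=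
    ⟨fun a b ⟨e, he, hab⟩ => ⟨e, he, hab.symm⟩⟩
  induction hqr with
  | refl => exact .refl
  | symm q r hqr ih => exact ReflTransGen.stdSymm.symm _ _ (ih ((h.eqvGen_touch_mem hqr).2 hq))
  | trans q r t hqr _ h1 h2 => exact (h1 hq).trans (h2 ((h.eqvGen_touch_mem hqr).1 hq))
  | rel q r hqr =>
    rcases hqr with h1 | ⟨h1, rfl, h3⟩
    · have : D.region q = D.region r := Quot.sound (Or.inl h1)
      rw [this]
    · have hqU := h3.1 hq
      obtain ⟨x, i⟩ := q
      by_cases hx : (D.elem x).IsCrossing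
      · exact .single ⟨x, hS x h1 hqU hx, h.isLink hx hq⟩
      · have e4 := (by decide : ∀ i : Fin 4, i + 2 + 2 = i) i
        have hi2 := (h.mem_opp x i).2 hq
        have hm := (hU x hx).1 hqU
        have c1 : (x, (1 : Fin 4)) ∈ σ ↔ (x, (0 : Fin 4)) ∉ σ := h.mem_succ x 0
        have c2 : (x, (2 : Fin 4)) ∈ σ ↔ (x, (0 : Fin 4)) ∈ σ := h.mem_opp x 0
        have c3 : (x, (3 : Fin 4)) ∈ σ ↔ (x, (1 : Fin 4)) ∈ σ := h.mem_opp x 1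
        suffices D.region (x, i) = D.region (x, i + 2) by rw [this]
        rcases hm with ⟨he, h0⟩ | ⟨he, h0⟩
        · have e : D.region (x, 0) = D.region (x, 2) :=
            Quot.sound (Or.inr ⟨rfl, by dsimp only; rw [he]; exact ⟨rfl, rfl⟩⟩)
          obtain rfl | rfl | rfl | rfl :=
            (by decide : ∀ i : Fin 4, i = 0 ∨ i = 1 ∨ i = 2 ∨ i = 3) i
          · exact e
          · exact (c1.1 hq h0).elim
          · exact e.symm
          · exact (c1.1 (c3.1 hq) h0).elim
        · have e : D.region (x, 1) = D.region (x, 3) :=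
            Quot.sound (Or.inr ⟨rfl, by dsimp only; rw [he]; exact ⟨rfl, rfl⟩⟩)
          obtain rfl | rfl | rfl | rfl :=
            (by decide : ∀ i : Fin 4, i = 0 ∨ i = 1 ∨ i = 2 ∨ i = 3) i
          · exact (c1.1 h0 hq).elim
          · exact e
          · exact (c1.1 h0 (c2.1 hq)).elim
          · exact e.symm

/-- At a node outside `U` the open channel joins unshaded corners, and a chain that starts at a
shaded corner never meets one. -/
theorem IsCheckerboard.touch_self_of_mem (h : D.IsCheckerboard σ) {U A : Set D.Node}
    {q r : D.Flag} (hqr : EqvGen (D.Touch σ U A) q r) (hq : q ∈ σ) :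
    EqvGen (D.Touch σ U U) q r := by
  induction hqr with
  | refl => exact .refl _
  | symm q r hqr ih => exact (ih ((h.eqvGen_touch_mem hqr).2 hq)).symm
  | trans q r t hqr _ h1 h2 => exact (h1 hq).trans _ _ _ (h2 ((h.eqvGen_touch_mem hqr).1 hq))
  | rel q r hqr =>
    rcases hqr with h1 | ⟨h1, h2, h3⟩
    · exact .rel _ _ (Or.inl h1)
    · exact .rel _ _ (Or.inr ⟨h3.1 hq, h2, h3⟩)

/-- On a union of spheres, an edge set of the Tait graph of a connected diagram is a spanning tree
if and only if the corresponding state consists of a single circle. -/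
theorem IsCheckerboard.isSpanningTree_iff (h : D.IsCheckerboard σ) (hD : D.IsConnected)
    (hF : Nat.card D.Node + 2 ≤ D.faceCount) {S : Set D.Node}
    (hS : ∀ x ∈ S, (D.elem x).IsCrossing) :
    (D.taitGraph σ).IsSpanningTree S ↔ D.OneCircle σ (S ∪ D.smoothedMerging σ) := by
  classical
  have := D.finite
  have hE := extends_union (σ := σ) hS
  have hcorner : ∀ x, ∃ i, (x, i) ∈ σ := fun x => by
    by_cases h0 : (x, (0 : Fin 4)) ∈ σ
    · exact ⟨0, h0⟩
    · exact ⟨0 + 1, (h.mem_succ x 0).2 h0⟩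
  constructor
  · rintro ⟨-, hconn, hacyc⟩
    -- The drawn smoothings must be seen to merge distinct shaded regions. Connectedness supplies a
    -- one-circle state `U₀` that contains them, and no channel of it is superfluous.
    obtain ⟨U₀, hE₀, hU₀⟩ := h.exists_oneCircle hD
    have step1 : ∀ T : Finset D.Node, (T : Set D.Node) ⊆ D.smoothedMerging σ →
        D.BoundsOneCircle σ T := by
      intro T
      induction T using Finset.induction_on with
      | empty => exact fun _ => by simpa using h.boundsOneCircle_empty
      | insert x T hx ih =>
        intro hT
        rw [Finset.coe_insert] at hT ⊢
        obtain ⟨i, hi⟩ := hcorner x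
        refine h.boundsOneCircle_insert (ih ((Set.subset_insert _ _).trans hT)) hi fun hc => ?_
        have hm : ∀ y ∈ D.smoothedMerging σ, y ∈ U₀ := fun y hy =>
          (hE₀ y (not_isCrossing_of_mem hy)).2 hy
        have hxm := hm x (hT (Set.mem_insert _ _))
        refine hU₀.not_touch h hF (x := x) (i := i) (by simp [hi, hxm]) ?_
        refine eqvGen_touch_mono ?_ ?_ hc
        · rintro y hy rfl
          exact hx hy
        · intro y hy
          exact ⟨fun _ => hm y (hT (Set.mem_insert_of_mem _ hy)), fun _ => hy⟩
    -- The edges of `S` are opened one by one; by acyclicity each joins two regions that are still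
    -- different.
    have step2 : ∀ T : Finset D.Node, (T : Set D.Node) ⊆ S →
        D.BoundsOneCircle σ (T ∪ D.smoothedMerging σ) := by
      intro T
      induction T using Finset.induction_on with
      | empty =>
        intro _
        have := step1 (D.smoothedMerging σ).toFinite.toFinset (by simp)
        simpa using this
      | insert x T hx ih =>
        intro hT
        rw [Finset.coe_insert] at hT ⊢
        rw [Set.insert_union]
        obtain ⟨i, hi⟩ := hcorner x
        have hxS := hT (Set.mem_insert _ _)
        have hTS := (Set.subset_insert _ _).trans hT
        refine h.boundsOneCircle_insert (ih hTS) hi fun hc => ?_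
        refine hacyc x hxS _ _ (h.isLink (hS x hxS) hi) ?_
        refine h.links_of_touch (extends_union fun y hy => hS y (hTS hy)) ?_ hc hi
        intro y hy _ hyc
        have hyT : y ∈ T := hy.resolve_right fun hy' => not_isCrossing_of_mem hy' hyc
        refine ⟨hTS hyT, ?_⟩
        rintro rfl
        exact hx hyT
    have hfull := step2 S.toFinite.toFinset (by simp)
    rw [Set.Finite.coe_toFinset] at hfull
    -- Connectedness of the tree makes all shaded corners one region, and that region is bounded by
    -- one circle.
    intro p q
    refine hfull p q (h.touch_self_of_mem (A := Set.univ) ?_ (h.shadedSide_mem p))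
    exact h.touch_of_links hE (fun _ _ => trivial) (Set.subset_univ S) Set.subset_union_left
      (hconn _ ⟨_, h.shadedSide_mem p, rfl⟩ _ ⟨_, h.shadedSide_mem q, rfl⟩)
  · intro hU
    refine ⟨fun x hx => ?_, ?_, ?_⟩
    · obtain ⟨i, hi⟩ := hcorner x
      exact ⟨_, _, h.isLink (hS x hx) hi⟩
    · rintro _ ⟨q, hq, rfl⟩ _ ⟨r, hr, rfl⟩
      refine h.links_of_touch hE ?_ (hU.touch h (Set.subset_univ _) hq hr) hq
      exact fun x _ hx hxc => hx.resolve_right fun hx' => not_isCrossing_of_mem hx' hxc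
    · rintro x hx _ _ ⟨hxc, i, hi, -, -, rfl, rfl⟩ hc
      refine hU.not_touch h hF (x := x) (i := i) (by simp [hi, hx]) ?_
      refine h.touch_of_links hE (fun y hy => ?_) (fun y hy => hy.2)
        (fun y hy => Or.inl hy.1) hc
      rintro rfl
      exact hy hxc

theorem _root_.Elem.PortsJoined.symm {e : Elem} {i j : Fin 4} (h : e.PortsJoined i j) :
    e.PortsJoined j i := by
  cases e with
  | pos => trivial
  | neg => trivial
  | vert =>
    have := (by decide : ∀ i j : Fin 4, j = i ∨ j = 3 - i → i = j ∨ i = 3 - j)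
    exact this i j h
  | horiz =>
    have := (by decide : ∀ i j : Fin 4, j = i ∨ j = 1 - i → i = j ∨ i = 1 - j)
    exact this i j h

theorem IsCheckerboard.joined_turn (h : D.IsCheckerboard σ) {U : Set D.Node}
    (hU : D.Extends σ U) (p : D.Flag) :
    (D.elem p.1).PortsJoined p.2 (D.turn σ U p).2 := by
  obtain ⟨x, i⟩ := p
  dsimp only
  have hx := hU x
  have c1 : (x, (1 : Fin 4)) ∈ σ ↔ (x, (0 : Fin 4)) ∉ σ := h.mem_succ x 0
  have c2 : (x, (2 : Fin 4)) ∈ σ ↔ (x, (0 : Fin 4)) ∈ σ := h.mem_opp x 0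
  have c3 : (x, (3 : Fin 4)) ∈ σ ↔ (x, (1 : Fin 4)) ∈ σ := h.mem_opp x 1
  cases he : D.elem x with
  | pos => trivial
  | neg => trivial
  | vert =>
    have hx' : x ∈ U ↔ (x, (0 : Fin 4)) ∈ σ := by
      rw [hx (by simp [Elem.IsCrossing, he])]; simp [smoothedMerging, he]
    refine Or.inr ?_
    fin_cases i <;> simp [turn, hx', c1, c2, c3]; rfl
  | horiz =>
    have hx' : x ∈ U ↔ (x, (1 : Fin 4)) ∈ σ := by
      rw [hx (by simp [Elem.IsCrossing, he])]; simp [smoothedMerging, he]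
    refine Or.inr ?_
    fin_cases i <;> simp [turn, hx', c1, c2, c3]

/-- The circles of a state that extends the drawing run along the projection. -/
theorem OneCircle.isConnected {U : Set D.Node} (hU : D.OneCircle σ U) (h : D.IsCheckerboard σ)
    (hE : D.Extends σ U) : D.IsConnected := by
  have hsymm : Std.Symm (fun a b : D.Flag =>
      b = D.glue a ∨ a.1 = b.1 ∧ (D.elem a.1).PortsJoined a.2 b.2) := by
    refine ⟨fun a b hab => ?_⟩
    rcases hab with rfl | ⟨h1, h2⟩
    · exact Or.inl (D.glue_glue a).symm
    · refine Or.inr ⟨h1.symm, ?_⟩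
      rw [← h1]
      exact h2.symm
  intro p q
  induction hU p q with
  | refl => exact .refl
  | symm _ _ _ ih => exact ReflTransGen.stdSymm.symm _ _ ih
  | trans _ _ _ _ _ h1 h2 => exact h1.trans h2
  | rel p q hpq =>
    rcases hpq with rfl | ⟨-, rfl⟩
    · exact .single (Or.inl rfl)
    · exact .single (Or.inr ⟨(turn_fst U p).symm, h.joined_turn hE p⟩)

/-- A connected diagram has at most two checkerboard colourings. -/
theorem IsCheckerboard.eq_or_eq_compl (h : D.IsCheckerboard σ) (hD : D.IsConnected)
    {τ : Set D.Flag} (hτ : D.IsCheckerboard τ) : τ = σ ∨ τ = σᶜ := by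
  rcases isEmpty_or_nonempty D.Flag with hE | ⟨⟨p₀⟩⟩
  · left; ext p; exact hE.elim p
  have hnode : ∀ x (i j : Fin 4), ((x, i) ∈ τ ↔ (x, i) ∈ σ) ↔ ((x, j) ∈ τ ↔ (x, j) ∈ σ) := by
    have : ∀ x (i : Fin 4), ((x, i) ∈ τ ↔ (x, i) ∈ σ) ↔ ((x, 0) ∈ τ ↔ (x, 0) ∈ σ) := by
      intro x i
      have a1 : (x, (1 : Fin 4)) ∈ σ ↔ (x, (0 : Fin 4)) ∉ σ := h.mem_succ x 0
      have a2 : (x, (2 : Fin 4)) ∈ σ ↔ (x, (0 : Fin 4)) ∈ σ := h.mem_opp x 0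
      have a3 : (x, (3 : Fin 4)) ∈ σ ↔ (x, (1 : Fin 4)) ∈ σ := h.mem_opp x 1
      have b1 : (x, (1 : Fin 4)) ∈ τ ↔ (x, (0 : Fin 4)) ∉ τ := hτ.mem_succ x 0
      have b2 : (x, (2 : Fin 4)) ∈ τ ↔ (x, (0 : Fin 4)) ∈ τ := hτ.mem_opp x 0
      have b3 : (x, (3 : Fin 4)) ∈ τ ↔ (x, (1 : Fin 4)) ∈ τ := hτ.mem_opp x 1
      obtain rfl | rfl | rfl | rfl :=
        (by decide : ∀ i : Fin 4, i = 0 ∨ i = 1 ∨ i = 2 ∨ i = 3) i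
      · rfl
      · rw [a1, b1, not_iff_not]
      · rw [a2, b2]
      · rw [a3, b3, a1, b1, not_iff_not]
    exact fun x i j => (this x i).trans (this x j).symm
  -- Whether the two colourings agree at a port does not change along the projection.
  have hall : ∀ p, (p ∈ τ ↔ p ∈ σ) ↔ (p₀ ∈ τ ↔ p₀ ∈ σ) := by
    intro p
    induction hD p₀ p with
    | refl => rfl
    | @tail b c _ hbc ih =>
      refine Iff.trans ?_ ih
      rcases hbc with rfl | ⟨h1, -⟩
      · rw [h.glue_mem, hτ.glue_mem, not_iff_not]
      · obtain ⟨x, i⟩ := b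
        obtain ⟨y, j⟩ := c
        obtain rfl : x = y := h1
        exact hnode x j i
  by_cases h0 : p₀ ∈ τ ↔ p₀ ∈ σ
  · left; ext p; exact (hall p).2 h0
  · right; ext p
    have := (not_congr (hall p)).2 h0
    rw [Set.mem_compl_iff]
    tauto

end Diagram

/-! ### The determinant as a sum over one-circle states. -/

namespace Diagram

open Relation

section StateSum

open Classical

noncomputable instance (D : Diagram) : Fintype D.Node := @Fintype.ofFinite _ D.finite

variable {D : Diagram} {σ : Set D.Flag}

/-- The sum, over the states with a single circle, of the product of the weights that the nodes
get in the state; `true` stands for the smoothing that merges the shaded corners. -/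
noncomputable def stateSum (D : Diagram) (σ : Set D.Flag) (W : D.Node → Bool → ℤ) : ℤ :=
  ∑ s : D.Node → Bool, if D.OneCircle σ {x | s x = true} then ∏ x, W x (s x) else 0

/-- The weight of a node in the signed count of spanning trees. -/
noncomputable def nodeWeight (D : Diagram) (σ : Set D.Flag) (x : D.Node) (u : Bool) : ℤ :=
  if (D.elem x).IsCrossing then if u = true ∧ D.IsPositiveEdge σ x then -1 else 1
  else if u = true ↔ x ∈ D.smoothedMerging σ then 1 else 0

theorem sum_neg_one_pow_mul_ncard {ι : Type*} [Fintype ι] (P : ι → Prop) (f : ι → ℕ) (n : ℕ)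
    (hf : ∀ i, f i ≤ n) :
    ∑ v ∈ Finset.range (n + 1), (-1 : ℤ) ^ v * (Set.ncard {i | P i ∧ f i = v} : ℤ) =
      ∑ i with P i, (-1) ^ f i := by
  rw [← Finset.sum_fiberwise_of_maps_to (g := f) (t := Finset.range (n + 1))
    fun i _ => Finset.mem_range.2 (Nat.lt_succ_of_le (hf i))]
  refine Finset.sum_congr rfl fun v _ => ?_
  rw [Finset.sum_congr rfl (g := fun _ => (-1 : ℤ) ^ v)
    fun i hi => by rw [(Finset.mem_filter.1 hi).2], Finset.sum_const, nsmul_eq_mul, mul_comm,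
    Finset.filter_filter, Set.ncard_eq_toFinset_card']
  congr 3
  ext i; simp

theorem prod_ite_neg_one {ι : Type*} [Fintype ι] (P : ι → Prop) :
    ∏ i, (if P i then (-1 : ℤ) else 1) = (-1) ^ Set.ncard {i | P i} := by
  rw [Finset.prod_ite, Finset.prod_const_one, mul_one, Finset.prod_const,
    Set.ncard_eq_toFinset_card']
  congr 2
  ext i; simp

theorem extends_of_prod_ne_zero {s : D.Node → Bool} (hs : ∏ x, D.nodeWeight σ x (s x) ≠ 0) :
    D.Extends σ {x | s x = true} := by
  intro x hx
  have h1 := Finset.prod_ne_zero_iff.1 hs x (Finset.mem_univ x)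
  rw [nodeWeight, if_neg hx] at h1
  by_contra h2
  exact h1 (if_neg h2)

/-- `S ↦ S ∪ smoothedMerging` matches the spanning trees with the one-circle states of nonzero
weight; the positive edges in `S` contribute the signs. -/
theorem treeSum_eq_stateSum (h : D.IsCheckerboard σ) (hD : D.IsConnected)
    (hF : Nat.card D.Node + 2 ≤ D.faceCount) :
    D.treeSum σ = D.stateSum σ (D.nodeWeight σ) := by
  have hcr : ∀ S, (D.taitGraph σ).IsSpanningTree S → ∀ x ∈ S, (D.elem x).IsCrossing := by
    intro S hS x hx
    obtain ⟨_, _, hc, -⟩ := hS.1 hx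
    exact hc
  unfold treeSum treeCount
  rw [sum_neg_one_pow_mul_ncard _ _ _ fun S => ?_]
  · let e : Set D.Node → D.Node → Bool := fun S x => decide (x ∈ S ∪ D.smoothedMerging σ)
    have he : ∀ S, {x | e S x = true} = S ∪ D.smoothedMerging σ := by
      intro S; ext x; simp [e]
    refine Finset.sum_of_injOn e ?_ (fun _ _ => Finset.mem_coe.2 (Finset.mem_univ _)) ?_ ?_
    · intro S hS T hT hST
      have hS := hcr S (Finset.mem_filter.1 hS).2
      have hT := hcr T (Finset.mem_filter.1 hT).2
      have h1 : S ∪ D.smoothedMerging σ = T ∪ D.smoothedMerging σ := by rw [← he, ← he, hST]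
      ext x
      have h2 : x ∈ S ∪ D.smoothedMerging σ ↔ x ∈ T ∪ D.smoothedMerging σ := by rw [h1]
      constructor
      · exact fun hx => (h2.1 (Or.inl hx)).resolve_right fun h' =>
          not_isCrossing_of_mem h' (hS x hx)
      · exact fun hx => (h2.2 (Or.inl hx)).resolve_right fun h' =>
          not_isCrossing_of_mem h' (hT x hx)
    · intro s _ hs
      split_ifs with hU
      · by_contra h0
        have hE := extends_of_prod_ne_zero h0
        have hset : {x | s x = true ∧ (D.elem x).IsCrossing} ∪ D.smoothedMerging σ =
            {x | s x = true} := by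
          ext x
          by_cases hx : (D.elem x).IsCrossing
          · have : x ∉ D.smoothedMerging σ := fun h' => not_isCrossing_of_mem h' hx
            simp [hx, this]
          · have := hE x hx
            simp only [Set.mem_union, Set.mem_ofPred_eq, hx, and_false, false_or]
            exact this.symm
        refine hs ⟨{x | s x = true ∧ (D.elem x).IsCrossing}, ?_, ?_⟩
        · simp only [Finset.coe_filter, Finset.mem_univ, true_and, Set.mem_ofPred_eq]
          rw [h.isSpanningTree_iff hD hF fun x hx => hx.2, hset]
          exact hU
        · ext x
          have : x ∈ {x | s x = true ∧ (D.elem x).IsCrossing} ∪ D.smoothedMerging σ ↔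
            s x = true := by rw [hset]; rfl
          simp only [e, this, Bool.decide_eq_true]
      · rfl
    · intro S hS
      have hS := (Finset.mem_filter.1 hS).2
      have hSc := hcr S hS
      rw [if_pos (by rw [he]; exact (h.isSpanningTree_iff hD hF hSc).1 hS)]
      have := prod_ite_neg_one fun x => x ∈ S ∧ D.IsPositiveEdge σ x
      refine (this.symm).trans (Finset.prod_congr rfl fun x _ => ?_)
      unfold nodeWeight
      by_cases hx : (D.elem x).IsCrossing
      · have : x ∉ D.smoothedMerging σ := fun h' => not_isCrossing_of_mem h' hx
        simp [hx, e, this]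
      · have : x ∉ S := fun h' => hx (hSc x h')
        simp [hx, e, this]
  · exact Set.ncard_le_card _

/-- The complementary colouring exchanges positive and negative edges, the complementary state
exchanges contraction and deletion. The factor is split so that its dependence on the state
multiplies up to `(-1)` to the number of merging nodes. -/
theorem nodeWeight_compl (h : D.IsCheckerboard σ) (x : D.Node) : ∃ c : ℤ, |c| = 1 ∧
    ∀ u, D.nodeWeight σᶜ x (!u) = D.nodeWeight σ x u * (c * if u = true then -1 else 1) := by
  have c1 : (x, (1 : Fin 4)) ∈ σ ↔ (x, (0 : Fin 4)) ∉ σ := h.mem_succ x 0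
  by_cases hx : (D.elem x).IsCrossing
  · have hp : D.IsPositiveEdge σᶜ x ↔ ¬ D.IsPositiveEdge σ x := by
      rcases hx with hx | hx <;> simp [IsPositiveEdge, hx, c1]
    by_cases hpos : D.IsPositiveEdge σ x
    · refine ⟨1, by simp, fun u => ?_⟩
      cases u <;> simp [nodeWeight, hx, hp, hpos]
    · refine ⟨-1, by simp, fun u => ?_⟩
      cases u <;> simp [nodeWeight, hx, hp, hpos]
  · have hm : x ∈ D.smoothedMerging σᶜ ↔ x ∉ D.smoothedMerging σ := by
      cases he : D.elem x with
      | pos => exact (hx (Or.inl he)).elim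
      | neg => exact (hx (Or.inr he)).elim
      | vert => simp [smoothedMerging, he]
      | horiz => simp [smoothedMerging, he]
    by_cases hmem : x ∈ D.smoothedMerging σ
    · refine ⟨-1, by simp, fun u => ?_⟩
      cases u <;> simp [nodeWeight, hx, hm, hmem]
    · refine ⟨1, by simp, fun u => ?_⟩
      cases u <;> simp [nodeWeight, hx, hm, hmem]

/-- All one-circle states merge at equally many nodes (`OneCircle.ncard_eq`), so the factors of
`nodeWeight_compl` amount to one global sign. -/
theorem abs_stateSum_compl (h : D.IsCheckerboard σ)
    (hF : Nat.card D.Node + 2 ≤ D.faceCount) :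
    |D.stateSum σᶜ (D.nodeWeight σᶜ)| = |D.stateSum σ (D.nodeWeight σ)| := by
  choose c hc1 hc using nodeWeight_compl h
  have hsum : D.stateSum σᶜ (D.nodeWeight σᶜ) = ∑ s : D.Node → Bool,
      if D.OneCircle σ {x | s x = true} then
        (∏ x, D.nodeWeight σ x (s x)) * ((∏ x, c x) * (-1) ^ Set.ncard {x | s x = true})
      else 0 := by
    unfold stateSum
    refine Fintype.sum_bijective (fun s x => !(s x))
      (Function.Involutive.bijective fun s => by simp) _ _ fun s => ?_
    have hs : {x | (!(s x)) = true} = {x | s x = true}ᶜ := by ext x; simp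
    have hiff : D.OneCircle σ {x | (!(s x)) = true} ↔ D.OneCircle σᶜ {x | s x = true} := by
      rw [hs, ← oneCircle_compl, compl_compl]
    simp only [hiff]
    refine if_congr Iff.rfl ?_ rfl
    rw [← prod_ite_neg_one, ← Finset.prod_mul_distrib, ← Finset.prod_mul_distrib]
    exact Finset.prod_congr rfl fun x _ => by
      have := hc x (!(s x))
      rw [Bool.not_not] at this
      convert this
  by_cases hex : ∃ s₀ : D.Node → Bool, D.OneCircle σ {x | s₀ x = true}
  · obtain ⟨s₀, hs₀⟩ := hex
    have : D.stateSum σᶜ (D.nodeWeight σᶜ) = D.stateSum σ (D.nodeWeight σ) *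
        ((∏ x, c x) * (-1) ^ Set.ncard {x | s₀ x = true}) := by
      rw [hsum, stateSum, Finset.sum_mul]
      refine Finset.sum_congr rfl fun s _ => ?_
      split_ifs with hs
      · rw [hs.ncard_eq hs₀ h hF]
      · rw [zero_mul]
    rw [this, abs_mul, abs_mul, abs_pow, Finset.abs_prod, Finset.prod_congr rfl fun x _ => hc1 x]
    simp
  · push Not at hex
    rw [hsum, stateSum]
    simp [hex]

theorem stateSum_eq_zero (h : D.IsCheckerboard σ) (hD : ¬ D.IsConnected) :
    D.stateSum σ (D.nodeWeight σ) = 0 := by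
  refine Finset.sum_eq_zero fun s _ => ?_
  split_ifs with hs
  · by_contra h0
    exact hD (hs.isConnected h (extends_of_prod_ne_zero h0))
  · rfl

/-- The determinant as a state sum, for any checkerboard colouring. -/
theorem det_eq_abs_stateSum (h : D.IsCheckerboard σ)
    (hF : D.IsConnected → Nat.card D.Node + 2 ≤ D.faceCount) :
    (D.det : ℤ) = |D.stateSum σ (D.nodeWeight σ)| := by
  unfold det
  by_cases hD : D.IsConnected
  · have hex : D.IsConnected ∧ ∃ σ, D.IsCheckerboard σ := ⟨hD, σ, h⟩
    rw [dif_pos hex, Int.natCast_natAbs,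
      treeSum_eq_stateSum hex.2.choose_spec hD (hF hD)]
    rcases h.eq_or_eq_compl hD hex.2.choose_spec with e | e
    · rw [e]
    · rw [e, abs_stateSum_compl h (hF hD)]
  · rw [dif_neg fun h' => hD h'.1, stateSum_eq_zero h hD]
    simp

/-- The part of the state sum in which the node `c` is in the state `u`, without its weight. -/
noncomputable def partialSum (D : Diagram) (σ : Set D.Flag) (W : D.Node → Bool → ℤ)
    (c : D.Node) (u : Bool) : ℤ :=
  ∑ t : {x // x ≠ c} → Bool,
    if D.OneCircle σ {x | (Equiv.funSplitAt c Bool).symm (u, t) x = true} then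
      ∏ x : {x // x ≠ c}, W x (t x) else 0

/-- Deletion (`false`) and contraction (`true`) of the edge of `c`. -/
theorem stateSum_split (W : D.Node → Bool → ℤ) (c : D.Node) :
    D.stateSum σ W = W c false * D.partialSum σ W c false + W c true * D.partialSum σ W c true := by
  unfold stateSum partialSum
  rw [← (Equiv.funSplitAt c Bool).symm.sum_comp, Fintype.sum_prod_type, Fintype.sum_bool, add_comm,
    Finset.mul_sum, Finset.mul_sum]
  have : ∀ u (t : {x // x ≠ c} → Bool),
      ∏ x, W x ((Equiv.funSplitAt c Bool).symm (u, t) x) = W c u * ∏ x : {x // x ≠ c}, W x (t x) := by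
    intro u t
    rw [Fintype.prod_eq_mul_prod_compl c]
    congr 1
    · simp
    · rw [Finset.prod_subtype (p := fun x => x ≠ c) _ (by simp)]
      refine Finset.prod_congr rfl fun x _ => ?_
      simp [x.2]
  simp only [this, mul_ite, mul_zero]

end StateSum

end Diagram

/-! ### Putting a new node beside an old one: colouring, faces and circles. -/

namespace Diagram

open Relation

variable {D : Diagram} {σ : Set D.Flag} {c : D.Node} {k : Fin 4} {e : Elem}

/-- The colouring of the enlarged diagram: the new node is shaded like the node it is put beside. -/
def attachColor (D : Diagram) (σ : Set D.Flag) (c : D.Node) (k : Fin 4) (e : Elem) :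
    Set (D.attach c k e).Flag :=
  {p : Option D.Node × Fin 4 | (p.1.getD c, p.2) ∈ σ}

theorem attachPort_getD (D : Diagram) (c : D.Node) (k : Fin 4) (p : D.Flag) :
    (D.attachPort c k p).1.getD c = p.1 := by
  unfold attachPort
  split_ifs with h
  · exact h.1.symm
  · rfl

theorem attachPort_snd (D : Diagram) (c : D.Node) (k : Fin 4) (p : D.Flag) :
    (D.attachPort c k p).2 = p.2 := by
  unfold attachPort
  split_ifs <;> rfl

theorem IsCheckerboard.attach (h : D.IsCheckerboard σ) (c : D.Node) (k : Fin 4) (e : Elem) :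
    (D.attach c k e).IsCheckerboard (D.attachColor σ c k e) := by
  refine ⟨fun x i => h.1 _ i, ?_⟩
  have h2 := fun i => h.mem_opp c i
  obtain ⟨e1, e2, e3, e4⟩ := D.attachGlue_inner c k
  intro q
  change ((D.attachGlue c k q).1.getD c, (D.attachGlue c k q).2 - 1) ∈ σ ↔ (q.1.getD c, q.2) ∈ σ
  rcases D.attach_cases c k q with ⟨p, rfl⟩ | rfl | rfl | rfl | rfl
  · simp only [attachGlue_attachPort, attachPort_getD, attachPort_snd]
    exact h.2 p
  · simp only [e1, Option.getD]
  · simp only [e2, Option.getD, h2, add_sub_cancel_right]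
  · simp only [e3, Option.getD]
    rw [(by decide : ∀ k : Fin 4, k - 1 - 1 = k + 2) k, h2]
  · simp only [e4, Option.getD]
    rw [(by decide : ∀ k : Fin 4, k + 2 - 1 = k + 1) k]

/-- Putting a new node beside an old one creates one more face. -/
theorem faceCount_attach (D : Diagram) (c : D.Node) (k : Fin 4) (e : Elem) :
    D.faceCount + 1 ≤ (D.attach c k e).faceCount := by
  classical
  have := D.finite
  have := (D.attach c k e).finite
  -- `none` is the new face, the bigon with corner `k + 2` of the new node and corner `k` of `c`.
  -- Every other corner goes to the old face from which it comes.
  let F : Option D.Node × Fin 4 → Option (Quot fun q r : D.Flag => r = D.across q) := fun q =>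
    if q = (none, k + 2) ∨ q = (some c, k) then none else some (Quot.mk _ (q.1.getD c, q.2))
  have hk : ∀ k : Fin 4, k - 1 ≠ k ∧ k - 1 ≠ k + 2 ∧ k + 2 - 1 = k + 1 ∧ k + 1 ≠ k ∧
    k + 1 ≠ k + 2 ∧ k ≠ k + 2 ∧ k - 1 - 1 = k + 2 ∧ k + 1 - 1 = k ∧
    (∀ j, j - 1 = k + 2 → j = k - 1) ∧ (∀ j, j - 1 = k → j = k + 1) := by decide
  obtain ⟨k1, k2, k3, k4, k5, k6, k7, k8, k9, k10⟩ := hk k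
  have hF : ∀ q, F q = F ((D.attachGlue c k q).1, (D.attachGlue c k q).2 - 1) := by
    intro q
    obtain ⟨e1, e2, e3, e4⟩ := D.attachGlue_inner c k
    rcases D.attach_cases c k q with ⟨p, rfl⟩ | rfl | rfl | rfl | rfl
    · rw [attachGlue_attachPort]
      have a1 : ∀ p, ¬ (D.attachPort c k p = (none, k + 2) ∨ D.attachPort c k p = (some c, k)) := by
        rintro ⟨x, j⟩
        unfold attachPort
        split_ifs with hx
        · rcases hx.2 with hj | hj <;> dsimp only at hj <;> subst hj <;> simp [k5, k6]
        · push Not at hx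
          simp only [Prod.mk.injEq, reduceCtorEq, false_and, Option.some.injEq, false_or]
          exact fun h' => (hx h'.1).1 h'.2
      have a2 : ∀ p, ¬ (((D.attachPort c k p).1, (D.attachPort c k p).2 - 1) = (none, k + 2) ∨
          ((D.attachPort c k p).1, (D.attachPort c k p).2 - 1) = (some c, k)) := by
        rintro ⟨x, j⟩
        unfold attachPort
        split_ifs with hx
        · simp only [Prod.mk.injEq, reduceCtorEq, false_and, or_false, true_and]
          intro hj
          have := k9 j hj
          rcases hx.2 with hj' | hj' <;> dsimp only at hj' <;> subst hj'
          · exact k1 this.symm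
          · exact (by decide : ∀ k : Fin 4, k + 1 ≠ k - 1) k this
        · push Not at hx
          simp only [Prod.mk.injEq, reduceCtorEq, false_and, Option.some.injEq, false_or]
          exact fun h' => (hx h'.1).2 (k10 j h'.2)
      simp only [F]
      rw [if_neg (a1 _), if_neg (a2 _)]
      simp only [attachPort_getD, attachPort_snd]
      exact congrArg some (Quot.sound rfl)
    · simp [F, e1, k1, k2]
    · simp [F, e2]
    · simp [F, e3, k7]
    · simp [F, e4, k3, k4, k5]
  unfold faceCount
  rw [← Finite.card_option]
  refine Nat.card_le_card_of_surjective (Quot.lift F ?_) ?_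
  · rintro q r rfl
    exact hF q
  · rintro (_ | ⟨x, j⟩)
    · exact ⟨Quot.mk _ (some c, k), if_pos (Or.inr rfl)⟩
    · by_cases hx : x = c ∧ j = k
      · obtain ⟨rfl, rfl⟩ := hx
        refine ⟨Quot.mk _ (none, j), if_neg ?_⟩
        rintro (h' | h')
        · exact k6 (congrArg Prod.snd h')
        · cases congrArg Prod.fst h'
      · refine ⟨Quot.mk _ (some x, j), if_neg ?_⟩
        rintro (h' | h')
        · cases congrArg Prod.fst h'
        · exact hx ⟨Option.some_injective _ (congrArg Prod.fst h'), congrArg Prod.snd h'⟩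

theorem card_attach (D : Diagram) (c : D.Node) (k : Fin 4) (e : Elem) :
    Nat.card (D.attach c k e).Node = Nat.card D.Node + 1 := by
  have := D.finite
  exact Finite.card_option

/-- The arcs at a node, one of which joins the ports `k` and `k + 1`. -/
theorem IsCheckerboard.turn_cap (h : D.IsCheckerboard σ) {U : Set D.Node} {x : D.Node}
    {k : Fin 4} (hc : (x, k) ∈ σ ↔ x ∉ U) :
    D.turn σ U (x, k) = (x, k + 1) ∧ D.turn σ U (x, k + 1) = (x, k) ∧
    D.turn σ U (x, k + 2) = (x, k - 1) ∧ D.turn σ U (x, k - 1) = (x, k + 2) := by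
  have t1 := turn_succ hc
  have t3 : D.turn σ U (x, k + 2) = (x, k + 2 + 1) := turn_succ ((h.mem_opp x k).trans hc)
  rw [(by decide : ∀ k : Fin 4, k + 2 + 1 = k - 1) k] at t3
  exact ⟨t1, by rw [← t1, h.turn_turn], t3, by rw [← t3, h.turn_turn]⟩

/-- The arcs at a node, two of which join the sides of the ports `k` and `k + 1`. -/
theorem IsCheckerboard.turn_through (h : D.IsCheckerboard σ) {U : Set D.Node} {x : D.Node}
    {k : Fin 4} (hc : (x, k) ∈ σ ↔ x ∈ U) :
    D.turn σ U (x, k) = (x, k - 1) ∧ D.turn σ U (x, k - 1) = (x, k) ∧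
    D.turn σ U (x, k + 1) = (x, k + 2) ∧ D.turn σ U (x, k + 2) = (x, k + 1) := by
  have t1 : D.turn σ U (x, k) = (x, k - 1) := turn_pred (by rw [hc]; exact iff_not_self)
  have t3 : D.turn σ U (x, k + 1) = (x, k + 1 + 1) :=
    turn_succ ((h.mem_succ x k).trans (not_congr hc))
  rw [add_assoc, (by decide : (1 : Fin 4) + 1 = 2)] at t3
  exact ⟨t1, by rw [← t1, h.turn_turn], t3, by rw [← t3, h.turn_turn]⟩

theorem four_cases (k j : Fin 4) : j = k ∨ j = k + 1 ∨ j = k + 2 ∨ j = k - 1 := by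
  revert j k; decide

open Classical in
/-- The arcs of a state at the nodes of an enlarged diagram. -/
noncomputable def attachTurn (D : Diagram) (σ : Set D.Flag) (c : D.Node)
    (U' : Set (Option D.Node)) (q : Option D.Node × Fin 4) : Option D.Node × Fin 4 :=
  if (q.1.getD c, q.2) ∈ σ ↔ q.1 ∉ U' then (q.1, q.2 + 1) else (q.1, q.2 - 1)

/-- One step along a state circle of an enlarged diagram. -/
def AttachStep (D : Diagram) (σ : Set D.Flag) (c : D.Node) (k : Fin 4) (U' : Set (Option D.Node))
    (q r : Option D.Node × Fin 4) : Prop :=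
  r = D.attachGlue c k q ∨ r = D.attachTurn σ c U' q

/-- The state `U'` of an enlarged diagram consists of a single circle. -/
def AttachOneCircle (D : Diagram) (σ : Set D.Flag) (c : D.Node) (k : Fin 4)
    (U' : Set (Option D.Node)) : Prop :=
  ∀ p q, EqvGen (D.AttachStep σ c k U') p q

/-- Circles depend on arcs and colours but not on the drawing; `AttachOneCircle` makes this visible
by not mentioning `e`. -/
theorem oneCircle_attach (U' : Set (Option D.Node)) :
    (D.attach c k e).OneCircle (D.attachColor σ c k e) U' ↔ D.AttachOneCircle σ c k U' := by
  have : (D.attach c k e).CircleStep (D.attachColor σ c k e) U' Set.univ =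
      D.AttachStep σ c k U' := by
    funext p q
    exact propext (or_congr Iff.rfl ⟨fun h' => h'.2, fun h' => ⟨trivial, h'⟩⟩)
  unfold OneCircle AttachOneCircle
  rw [this]
  exact Iff.rfl

theorem IsCheckerboard.attachTurn_cap (h : D.IsCheckerboard σ) {U' : Set (Option D.Node)}
    {x : Option D.Node} (hc : (x.getD c, k) ∈ σ ↔ x ∉ U') :
    D.attachTurn σ c U' (x, k) = (x, k + 1) ∧ D.attachTurn σ c U' (x, k + 1) = (x, k) ∧
    D.attachTurn σ c U' (x, k + 2) = (x, k - 1) ∧ D.attachTurn σ c U' (x, k - 1) = (x, k + 2) :=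
  (h.attach c k .pos).turn_cap (U := U') (x := x) hc

theorem IsCheckerboard.attachTurn_through (h : D.IsCheckerboard σ) {U' : Set (Option D.Node)}
    {x : Option D.Node} (hc : (x.getD c, k) ∈ σ ↔ x ∈ U') :
    D.attachTurn σ c U' (x, k) = (x, k - 1) ∧ D.attachTurn σ c U' (x, k - 1) = (x, k) ∧
    D.attachTurn σ c U' (x, k + 1) = (x, k + 2) ∧ D.attachTurn σ c U' (x, k + 2) = (x, k + 1) :=
  (h.attach c k .pos).turn_through (U := U') (x := x) hc

theorem turn_attach {U : Set D.Node} {U' : Set (Option D.Node)} {y : D.Node}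
    {x : Option D.Node} (hxy : x.getD c = y) (hU : x ∈ U' ↔ y ∈ U) (j : Fin 4) :
    D.attachTurn σ c U' (x, j) = (x, (D.turn σ U (y, j)).2) := by
  subst hxy
  unfold attachTurn turn
  dsimp only
  split_ifs <;> first | rfl | tauto

/-- How an enlarged state retracts to a state of the original diagram. -/
theorem oneCircle_attach_of_retract {U : Set D.Node} {U' : Set (Option D.Node)}
    (hU : ∀ x ≠ c, (some x ∈ U' ↔ x ∈ U)) (π : Option D.Node × Fin 4 → D.Flag)
    (h1 : ∀ p, π (D.attachPort c k p) = p)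
    (h2 : π (none, k - 1) = π (some c, k) ∧ π (none, k + 2) = π (some c, k + 1))
    (h3 : ∀ q : Option D.Node × Fin 4, EqvGen (D.CircleStep σ U Set.univ) (π q)
      (π (D.attachTurn σ c U' q)))
    (h4 : ∀ q : Option D.Node × Fin 4,
      EqvGen (D.AttachStep σ c k U') q
        (D.attachPort c k (π q)))
    (h5 : ∀ j, EqvGen (D.AttachStep σ c k U')
        (D.attachPort c k (c, j)) (D.attachPort c k (D.turn σ U (c, j)))) :
    D.AttachOneCircle σ c k U' ↔ D.OneCircle σ U := by
  obtain ⟨e1, e2, e3, e4⟩ := D.attachGlue_inner c k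
  constructor
  · intro hO p q
    rw [← h1 p, ← h1 q]
    refine eqvGen_lift π ?_ (hO (D.attachPort c k p) (D.attachPort c k q))
    rintro a b (rfl | rfl)
    · rcases D.attach_cases c k a with ⟨p, rfl⟩ | rfl | rfl | rfl | rfl
      · rw [attachGlue_attachPort, h1, h1]
        exact .rel _ _ (Or.inl rfl)
      · rw [e1, h2.1]; exact .refl _
      · rw [e2, h2.2]; exact .refl _
      · rw [e3, h2.1]; exact .refl _
      · rw [e4, h2.2]; exact .refl _
    · exact h3 a
  · intro hO p q
    refine (h4 p).trans _ _ _ (.trans _ _ _ ?_ (h4 q).symm)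
    refine eqvGen_lift (D.attachPort c k) ?_ (hO (π p) (π q))
    rintro ⟨x, j⟩ b (rfl | ⟨-, rfl⟩)
    · exact .rel _ _ (Or.inl (D.attachGlue_attachPort c k _).symm)
    · by_cases hx : x = c
      · subst hx; exact h5 j
      · have a1 : D.attachPort c k (x, j) = (some x, j) := if_neg fun h' => hx h'.1
        have a2 : D.attachPort c k (D.turn σ U (x, j)) = (some x, (D.turn σ U (x, j)).2) := by
          rw [attachPort, if_neg fun h' => hx ((turn_fst U _).symm.trans h'.1), turn_fst]
        rw [a1, a2, ← turn_attach (c := c) (y := x) (x := some x) rfl (hU x hx)]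
        exact .rel _ _ (Or.inr rfl)

theorem attachPort_left (D : Diagram) (c : D.Node) (k : Fin 4) :
    D.attachPort c k (c, k) = (none, k) ∧ D.attachPort c k (c, k + 1) = (none, k + 1) ∧
    D.attachPort c k (c, k + 2) = (some c, k + 2) ∧
    D.attachPort c k (c, k - 1) = (some c, k - 1) := by
  have hk : ∀ k : Fin 4, k + 2 ≠ k ∧ k + 2 ≠ k + 1 ∧ k - 1 ≠ k ∧ k - 1 ≠ k + 1 := by decide
  obtain ⟨k1, k2, k3, k4⟩ := hk k
  refine ⟨if_pos ⟨rfl, Or.inl rfl⟩, if_pos ⟨rfl, Or.inr rfl⟩, if_neg ?_, if_neg ?_⟩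
  · rintro ⟨-, h | h⟩
    exacts [k1 h, k2 h]
  · rintro ⟨-, h | h⟩
    exacts [k3 h, k4 h]

/-- If the arcs at `c` lead straight to the new node, the new node takes the place of `c`. -/
theorem IsCheckerboard.oneCircle_attach_through (h : D.IsCheckerboard σ) {U : Set D.Node}
    {U' : Set (Option D.Node)} (hU : ∀ x ≠ c, (some x ∈ U' ↔ x ∈ U))
    (hc : (c, k) ∈ σ ↔ some c ∈ U') (hn : none ∈ U' ↔ c ∈ U) :
    D.AttachOneCircle σ c k U' ↔ D.OneCircle σ U := by
  classical
  obtain ⟨e1, e2, e3, e4⟩ := D.attachGlue_inner c k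
  obtain ⟨p1, p2, p3, p4⟩ := D.attachPort_left c k
  obtain ⟨t1, t2, t3, t4⟩ := h.attachTurn_through (c := c) (U' := U') (x := some c) hc
  have tn : ∀ j, D.attachTurn σ c U' (none, j) =
    (none, (D.turn σ U (c, j)).2) := turn_attach rfl hn
  have hk : ∀ k : Fin 4, k + 1 ≠ k ∧ k + 2 ≠ k ∧ k + 2 ≠ k + 1 ∧ k - 1 ≠ k ∧ k - 1 ≠ k + 1 := by
    decide
  obtain ⟨k1, k2, k3, k4, k5⟩ := hk k
  set R := EqvGen (D.AttachStep σ c k U') with hR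
  have rglue : ∀ q : Option D.Node × Fin 4, R q (D.attachGlue c k q) :=
    fun q => .rel _ _ (Or.inl rfl)
  have rturn : ∀ q : Option D.Node × Fin 4,
      R q (D.attachTurn σ c U' q) :=
    fun q => .rel _ _ (Or.inr rfl)
  have g3 := rglue (some c, k)
  have g4 := rglue (some c, k + 1)
  have r2 := rturn (some c, k - 1)
  have r4 := rturn (some c, k + 2)
  rw [e3] at g3
  rw [e4] at g4
  rw [t2] at r2
  rw [t4] at r4
  have hport : ∀ j, R (D.attachPort c k (c, j)) (none, j) := by
    intro j
    rcases four_cases k j with rfl | rfl | rfl | rfl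
    · rw [p1]; exact .refl _
    · rw [p2]; exact .refl _
    · rw [p3]; exact r4.trans _ _ _ g4
    · rw [p4]; exact r2.trans _ _ _ g3
  -- The ports of the new node become those of `c`; the ports of `c` that face it slide along their
  -- arcs to the far side of `c`.
  let π : Option D.Node × Fin 4 → D.Flag := fun q =>
    if q = (some c, k) then (c, k - 1) else if q = (some c, k + 1) then (c, k + 2)
    else (q.1.getD c, q.2)
  have πn : ∀ j, π (none, j) = (c, j) := by intro j; simp [π]
  have π1 : π (some c, k) = (c, k - 1) := by simp [π]
  have π2 : π (some c, k + 1) = (c, k + 2) := by simp [π, k1]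
  have π3 : π (some c, k + 2) = (c, k + 2) := by simp [π, k2, k3]
  have π4 : π (some c, k - 1) = (c, k - 1) := by simp [π, k4, k5]
  have πx : ∀ x j, x ≠ c → π (some x, j) = (x, j) := by intro x j hx; simp [π, hx]
  refine oneCircle_attach_of_retract hU π ?_ ?_ ?_ ?_ ?_
  · rintro ⟨x, j⟩
    by_cases hx : x = c
    · subst hx
      rcases four_cases k j with rfl | rfl | rfl | rfl
      · rw [p1, πn]
      · rw [p2, πn]
      · rw [p3, π3]
      · rw [p4, π4]
    · rw [attachPort, if_neg fun h' => hx h'.1, πx _ _ hx]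
  · rw [πn, πn, π1, π2]; exact ⟨rfl, rfl⟩
  · rintro ⟨_ | x, j⟩
    · rw [tn, πn, πn]
      exact .rel _ _ (Or.inr ⟨trivial, Prod.ext (turn_fst U (c, j)).symm rfl⟩)
    · by_cases hx : x = c
      · subst hx
        rcases four_cases k j with rfl | rfl | rfl | rfl
        · rw [t1, π1, π4]; exact .refl _
        · rw [t3, π2, π3]; exact .refl _
        · rw [t4, π2, π3]; exact .refl _
        · rw [t2, π1, π4]; exact .refl _
      · rw [turn_attach (y := x) (x := some x) rfl (hU x hx), πx _ _ hx, πx _ _ hx]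
        exact .rel _ _ (Or.inr ⟨trivial, Prod.ext (turn_fst U (x, j)).symm rfl⟩)
  · rintro ⟨_ | x, j⟩
    · rw [πn]; exact (hport j).symm
    · by_cases hx : x = c
      · subst hx
        rcases four_cases k j with rfl | rfl | rfl | rfl
        · rw [π1, p4]; exact r2.symm
        · rw [π2, p3]; exact r4.symm
        · rw [π3, p3]; exact .refl _
        · rw [π4, p4]; exact .refl _
      · rw [πx _ _ hx, attachPort, if_neg fun h' => hx h'.1]; exact .refl _
  · intro j
    have e : D.turn σ U (c, j) = (c, (D.turn σ U (c, j)).2) := Prod.ext (turn_fst U _) rfl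
    have r := rturn (none, j)
    rw [tn] at r
    rw [e]
    exact (hport j).trans _ _ _ (r.trans _ _ _ (hport _).symm)

/-- If the arcs at the new node lead straight to `c`, the new node can be left out. -/
theorem IsCheckerboard.oneCircle_attach_cap (h : D.IsCheckerboard σ) {U : Set D.Node}
    {U' : Set (Option D.Node)} (hU : ∀ x ≠ c, (some x ∈ U' ↔ x ∈ U))
    (hc : some c ∈ U' ↔ c ∈ U) (hn : (c, k) ∈ σ ↔ none ∈ U') :
    D.AttachOneCircle σ c k U' ↔ D.OneCircle σ U := by
  classical
  obtain ⟨e1, e2, e3, e4⟩ := D.attachGlue_inner c k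
  obtain ⟨p1, p2, p3, p4⟩ := D.attachPort_left c k
  obtain ⟨t1, t2, t3, t4⟩ := h.attachTurn_through (c := c) (U' := U') (x := none) hn
  have hU' : ∀ x, (some x ∈ U' ↔ x ∈ U) := fun x => by
    by_cases hx : x = c
    · rw [hx]; exact hc
    · exact hU x hx
  have ts : ∀ x j, D.attachTurn σ c U' (some x, j) =
    (some x, (D.turn σ U (x, j)).2) := fun x => turn_attach rfl (hU' x)
  have hk : ∀ k : Fin 4, k + 1 ≠ k ∧ k + 2 ≠ k ∧ k + 2 ≠ k + 1 ∧ k - 1 ≠ k ∧ k - 1 ≠ k + 1 := by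
    decide
  obtain ⟨k1, k2, k3, k4, k5⟩ := hk k
  set R := EqvGen (D.AttachStep σ c k U') with hR
  have rglue : ∀ q : Option D.Node × Fin 4, R q (D.attachGlue c k q) :=
    fun q => .rel _ _ (Or.inl rfl)
  have rturn : ∀ q : Option D.Node × Fin 4,
      R q (D.attachTurn σ c U' q) :=
    fun q => .rel _ _ (Or.inr rfl)
  have g1 := rglue (none, k - 1)
  have g2 := rglue (none, k + 2)
  have r1 := rturn (none, k)
  have r3 := rturn (none, k + 1)
  rw [e1] at g1
  rw [e2] at g2
  rw [t1] at r1
  rw [t3] at r3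
  have hport : ∀ j, R (D.attachPort c k (c, j)) (some c, j) := by
    intro j
    rcases four_cases k j with rfl | rfl | rfl | rfl
    · rw [p1]; exact r1.trans _ _ _ g1
    · rw [p2]; exact r3.trans _ _ _ g2
    · rw [p3]; exact .refl _
    · rw [p4]; exact .refl _
  -- The two arcs at the new node shrink to the ports `k` and `k + 1` of `c`.
  let π : Option D.Node × Fin 4 → D.Flag := fun q =>
    q.1.elim (if q.2 = k ∨ q.2 = k - 1 then (c, k) else (c, k + 1)) fun x => (x, q.2)
  have πs : ∀ x j, π (some x, j) = (x, j) := fun x j => rfl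
  have π1 : π (none, k) = (c, k) := by simp [π]
  have π2 : π (none, k + 1) = (c, k + 1) := by simp [π, k1, k5.symm]
  have π3 : π (none, k + 2) = (c, k + 1) := by
    have : k + 2 ≠ k - 1 := by clear * -; revert k; decide
    simp [π, k2, this]
  have π4 : π (none, k - 1) = (c, k) := by simp [π]
  refine oneCircle_attach_of_retract hU π ?_ ?_ ?_ ?_ ?_
  · rintro ⟨x, j⟩
    by_cases hx : x = c
    · subst hx
      rcases four_cases k j with rfl | rfl | rfl | rfl
      · rw [p1, π1]
      · rw [p2, π2]
      · rw [p3, πs]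
      · rw [p4, πs]
    · rw [attachPort, if_neg fun h' => hx h'.1, πs]
  · rw [πs, πs, π4, π3]; exact ⟨rfl, rfl⟩
  · rintro ⟨_ | x, j⟩
    · rcases four_cases k j with rfl | rfl | rfl | rfl
      · rw [t1, π1, π4]; exact .refl _
      · rw [t3, π2, π3]; exact .refl _
      · rw [t4, π2, π3]; exact .refl _
      · rw [t2, π1, π4]; exact .refl _
    · rw [ts, πs, πs]
      exact .rel _ _ (Or.inr ⟨trivial, Prod.ext (turn_fst U (x, j)).symm rfl⟩)
  · rintro ⟨_ | x, j⟩
    · rcases four_cases k j with rfl | rfl | rfl | rfl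
      · rw [π1, p1]; exact .refl _
      · rw [π2, p2]; exact .refl _
      · rw [π3, p2]; exact r3.symm
      · rw [π4, p1]; exact r1.symm
    · rw [πs]
      by_cases hx : x = c
      · subst hx; exact (hport j).symm
      · rw [attachPort, if_neg fun h' => hx h'.1]; exact .refl _
  · intro j
    have e : D.turn σ U (c, j) = (c, (D.turn σ U (c, j)).2) := Prod.ext (turn_fst U _) rfl
    have r := rturn (some c, j)
    rw [ts] at r
    rw [e]
    exact (hport j).trans _ _ _ (r.trans _ _ _ (hport _).symm)

/-- If neither node lets the arcs pass, they close up to a separate circle. -/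
theorem IsCheckerboard.not_oneCircle_attach (h : D.IsCheckerboard σ)
    {U' : Set (Option D.Node)} (hc : (c, k) ∈ σ ↔ some c ∉ U')
    (hn : (c, k) ∈ σ ↔ none ∉ U') :
    ¬ D.AttachOneCircle σ c k U' := by
  intro hO
  obtain ⟨e1, e2, e3, e4⟩ := D.attachGlue_inner c k
  obtain ⟨s1, s2, s3, s4⟩ := h.attachTurn_cap (c := c) (U' := U') (x := some c) hc
  obtain ⟨t1, t2, t3, t4⟩ := h.attachTurn_cap (c := c) (U' := U') (x := none) hn
  have hk : ∀ k : Fin 4, k + 1 ≠ k ∧ k + 2 ≠ k ∧ k + 2 ≠ k + 1 ∧ k - 1 ≠ k ∧ k - 1 ≠ k + 1 := by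
    decide
  obtain ⟨k1, k2, k3, k4, k5⟩ := hk k
  -- `Z` is the small circle through the four ports that face each other; no port inherited from `D`
  -- lies on it.
  let Z : Option D.Node × Fin 4 → Prop := fun q => q.1 = none ∧ (q.2 = k - 1 ∨ q.2 = k + 2) ∨
    q.1 = some c ∧ (q.2 = k ∨ q.2 = k + 1)
  have hkZ : k ≠ k - 1 ∧ k ≠ k + 2 ∧ k + 1 ≠ k - 1 ∧ k + 1 ≠ k + 2 := by
    clear * -; revert k; decide
  obtain ⟨k6, k7, k8, k9⟩ := hkZ
  have hap : ∀ p, ¬ Z (D.attachPort c k p) := by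
    rintro ⟨x, j⟩
    unfold attachPort
    split_ifs with hx
    · rcases hx.2 with hj | hj <;> dsimp only at hj <;> subst hj <;> simp [Z, k6, k7, k8, k9]
    · dsimp only at hx
      simp only [Z, reduceCtorEq, false_and, Option.some.injEq, false_or]
      exact hx
  have inv : ∀ p q, EqvGen (D.AttachStep σ c k U') p q →
      (Z p ↔ Z q) := by
    intro p q hpq
    induction hpq with
    | refl => rfl
    | symm _ _ _ ih => exact ih.symm
    | trans _ _ _ _ _ h1 h2 => exact h1.trans h2
    | rel p q hpq =>
      rcases hpq with rfl | rfl
      · rcases D.attach_cases c k p with ⟨p, rfl⟩ | rfl | rfl | rfl | rfl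
        · rw [attachGlue_attachPort]
          exact iff_of_false (hap _) (hap _)
        · rw [e1]; simp [Z]
        · rw [e2]; simp [Z]
        · rw [e3]; simp [Z]
        · rw [e4]; simp [Z]
      · obtain ⟨_ | x, j⟩ := p
        · rcases four_cases k j with rfl | rfl | rfl | rfl
          · rw [t1]; simp [Z, k6, k7, k8, k9]
          · rw [t2]; simp [Z, k6, k7, k8, k9]
          · rw [t3]; simp [Z]
          · rw [t4]; simp [Z]
        · by_cases hx : x = c
          · subst hx
            rcases four_cases k j with rfl | rfl | rfl | rfl
            · rw [s1]; simp [Z]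
            · rw [s2]; simp [Z]
            · rw [s3]; simp [Z, k2, k3, k4, k5]
            · rw [s4]; simp [Z, k2, k3, k4, k5]
          · have e : (D.attachTurn σ c U' (some x, j)).1 = some x := by
              unfold attachTurn; split_ifs <;> rfl
            refine iff_of_false ?_ ?_
            · simp [Z, hx]
            · simp [Z, e, hx]
  have h1 : Z (some c, k) := by simp [Z]
  have h2 : ¬ Z (none, k) := by simp [Z, k6, k7]
  exact h2 ((inv _ _ (hO (some c, k) (none, k))).1 h1)

end Diagram

/-! ### Weights of tangles as generalized edges. -/

/-- The weights of a node drawn as `e` for the two smoothings (`true` merges the shaded corners);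
`b` says whether W and E are shaded. -/
def Elem.weight (e : Elem) (b u : Bool) : ℤ :=
  match e with
  | .pos => if u = true ∧ b = true then -1 else 1
  | .neg => if u = true ∧ b = false then -1 else 1
  | .vert => if u = b then 0 else 1
  | .horiz => if u = b then 1 else 0

/-- The weights of two edges in series. -/
def seriesWeight (w z : Bool → ℤ) (u : Bool) : ℤ :=
  -- Deleting both edges would isolate the vertex between them, so that term is missing.
  if u = true then w true * z true else w false * z true + w true * z false

/-- The weights of two parallel edges. -/
def parallelWeight (w z : Bool → ℤ) (u : Bool) : ℤ :=
  -- Contracting both edges would close a cycle, so that term is missing.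
  if u = true then w false * z true + w true * z false else w false * z false

/-- The weights of a tangle as a generalized edge of the Tait graph. -/
def TwistTangle.weight (b : Bool) : TwistTangle → Bool → ℤ
  | .elem e => e.weight b
  | .addEast T e =>
    -- A shaded bigon between `T` and `e` is a vertex on a path of two edges; an unshaded one is a
    -- face between parallel edges.
    if b = true then seriesWeight (T.weight b) (e.weight b)
    else parallelWeight (T.weight b) (e.weight b)
  | .addSouth T e =>
    if b = true then parallelWeight (T.weight b) (e.weight b)
    else seriesWeight (T.weight b) (e.weight b)

/-! ### State sums after a node has been replaced by a tangle. -/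

namespace Diagram

open Relation

section StateSum

open Classical

variable {D : Diagram} {σ : Set D.Flag} {c : D.Node} {k : Fin 4} {e : Elem}

theorem nodeWeight_eq (h : D.IsCheckerboard σ) {x : D.Node} {b : Bool}
    (hb : (x, 1) ∈ σ ↔ b = true) (u : Bool) :
    D.nodeWeight σ x u = (D.elem x).weight b u := by
  have c1 : (x, (1 : Fin 4)) ∈ σ ↔ (x, (0 : Fin 4)) ∉ σ := h.mem_succ x 0
  have c0 : (x, (0 : Fin 4)) ∈ σ ↔ ¬ b = true := by rw [← hb, c1, not_not]
  cases he : D.elem x <;> cases u <;> cases b <;>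
    simp [nodeWeight, Elem.IsCrossing, IsPositiveEdge, smoothedMerging, Elem.weight, he, c0, hb]

theorem funSplitAt_symm_self (u : Bool) (t : {x // x ≠ c} → Bool) :
    (Equiv.funSplitAt c Bool).symm (u, t) c = u := by
  simp [Equiv.funSplitAt_symm_apply]

theorem funSplitAt_symm_of_ne (u : Bool) (t : {x // x ≠ c} → Bool) {x : D.Node} (hx : x ≠ c) :
    (Equiv.funSplitAt c Bool).symm (u, t) x = t ⟨x, hx⟩ := by
  simp [Equiv.funSplitAt_symm_apply, hx]

theorem partialSum_congr {W W' : D.Node → Bool → ℤ} (hW : ∀ x ≠ c, W x = W' x) (u : Bool) :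
    D.partialSum σ W c u = D.partialSum σ W' c u := by
  unfold partialSum
  refine Finset.sum_congr rfl fun t _ => if_congr Iff.rfl ?_ rfl
  exact Finset.prod_congr rfl fun x _ => by rw [hW x.1 x.2]

/-- The state of an enlarged diagram put together from its parts. -/
noncomputable def attachState (D : Diagram) (c : D.Node) (v u : Bool)
    (t : {x : D.Node // x ≠ c} → Bool) (x : Option D.Node) : Bool :=
  x.elim u fun x => if hx : x = c then v else t ⟨x, hx⟩

/-- The contribution of the states with given smoothings of both nodes to the state sum of an
enlarged diagram. -/
noncomputable def pairSum (D : Diagram) (σ : Set D.Flag) (W : D.Node → Bool → ℤ) (c : D.Node)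
    (k : Fin 4) (v u : Bool) : ℤ :=
  ∑ t : {x : D.Node // x ≠ c} → Bool,
    if D.AttachOneCircle σ c k {x | D.attachState c v u t x = true} then
      ∏ x : {x // x ≠ c}, W x (t x) else 0

/-- The nodes of an enlarged diagram other than the old node `c`. -/
def attachNodeEquiv (D : Diagram) (c : D.Node) :
    Option {x : D.Node // x ≠ c} ≃ {x : Option D.Node // x ≠ some c} where
  toFun y := ⟨y.map Subtype.val, by
    rcases y with _ | ⟨x, hx⟩
    · simp
    · simpa using hx⟩
  invFun y := match y with
    | ⟨none, _⟩ => none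
    | ⟨some x, hx⟩ => some ⟨x, fun h => hx (congrArg some h)⟩
  left_inv := by rintro (_ | ⟨x, hx⟩) <;> rfl
  right_inv := by rintro ⟨_ | x, hx⟩ <;> rfl

theorem partialSum_attach (W : D.Node → Bool → ℤ) (W' : (D.attach c k e).Node → Bool → ℤ)
    (hW : ∀ x ≠ c, W' (some x) = W x) (v : Bool) :
    (D.attach c k e).partialSum (D.attachColor σ c k e) W' (some c) v =
      W' none false * D.pairSum σ W c k v false + W' none true * D.pairSum σ W c k v true := by
  let E : ({x : Option D.Node // x ≠ some c} → Bool) ≃ Bool × ({x : D.Node // x ≠ c} → Bool) :=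
    ((D.attachNodeEquiv c).arrowCongr (Equiv.refl Bool)).symm.trans Equiv.piOptionEquivProd
  have key : (D.attach c k e).partialSum (D.attachColor σ c k e) W' (some c) v =
      ∑ p : Bool × ({x : D.Node // x ≠ c} → Bool),
        if D.AttachOneCircle σ c k {x | D.attachState c v p.1 p.2 x = true} then
          W' none p.1 * ∏ x : {x // x ≠ c}, W x (p.2 x) else 0 := by
    unfold partialSum
    refine @Fintype.sum_equiv _ _ ℤ (_) (_) _ E _ _ fun t => ?_
    refine if_congr ?_ ?_ rfl
    · have : {x | (Equiv.funSplitAt (α := (D.attach c k e).Node) (some c) Bool).symm (v, t) x = true} =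
          {x | D.attachState c v (E t).1 (E t).2 x = true} := by
        ext x
        rcases x with _ | x
        · exact iff_of_eq (congrArg (· = true)
            (funSplitAt_symm_of_ne (D := D.attach c k e) (c := some c) v t (x := none) nofun))
        · by_cases hx : x = c
          · subst hx
            refine iff_of_eq (congrArg (· = true)
              ((funSplitAt_symm_self (D := D.attach x k e) (c := some x) v t).trans ?_))
            simp only [attachState, Option.elim, dif_pos]
          · refine iff_of_eq (congrArg (· = true)
              ((funSplitAt_symm_of_ne (D := D.attach c k e) (c := some c) v t (x := some x)
                fun h' => hx (Option.some_injective _ h')).trans ?_))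
            simp only [attachState, Option.elim, dif_neg hx]
            rfl
      rw [this]
      exact oneCircle_attach _
    · refine (@Fintype.prod_equiv _ _ ℤ inferInstance (_) _ (D.attachNodeEquiv c)
        (fun y => W' (y.map Subtype.val) (t (D.attachNodeEquiv c y)))
        (fun x => W' x.1 (t x)) fun y => rfl).symm.trans ?_
      rw [Fintype.prod_option]
      refine congrArg₂ _ rfl (Finset.prod_congr rfl fun x _ => ?_)
      exact congrFun (hW x.1 x.2) _
  rw [key, Fintype.sum_prod_type, Fintype.sum_bool, add_comm]
  simp only [pairSum, Finset.mul_sum, mul_ite, mul_zero]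

theorem mem_attachState {v u w : Bool} {t : {x : D.Node // x ≠ c} → Bool} {x : D.Node}
    (hx : x ≠ c) : some x ∈ {x | D.attachState c v u t x = true} ↔
      x ∈ {x | (Equiv.funSplitAt c Bool).symm (w, t) x = true} := by
  change _ = true ↔ _ = true
  rw [funSplitAt_symm_of_ne _ _ hx]
  simp only [attachState, Option.elim, dif_neg hx]

theorem mem_attachState_self {v u : Bool} {t : {x : D.Node // x ≠ c} → Bool} :
    some c ∈ {x | D.attachState c v u t x = true} ↔ v = true := by
  simp [attachState]

theorem mem_attachState_none {v u : Bool} {t : {x : D.Node // x ≠ c} → Bool} :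
    none ∈ {x | D.attachState c v u t x = true} ↔ u = true := Iff.rfl

theorem mem_funSplitAt_self {w : Bool} {t : {x : D.Node // x ≠ c} → Bool} :
    c ∈ {x | (Equiv.funSplitAt c Bool).symm (w, t) x = true} ↔ w = true := by
  change _ = true ↔ _
  rw [funSplitAt_symm_self]

theorem pairSum_through (h : D.IsCheckerboard σ) (W : D.Node → Bool → ℤ) {v u : Bool}
    (hv : (c, k) ∈ σ ↔ v = true) : D.pairSum σ W c k v u = D.partialSum σ W c u := by
  refine Finset.sum_congr rfl fun t _ => if_congr ?_ rfl rfl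
  exact h.oneCircle_attach_through (fun x hx => mem_attachState hx)
    (hv.trans mem_attachState_self.symm) (mem_attachState_none.trans mem_funSplitAt_self.symm)

theorem pairSum_cap (h : D.IsCheckerboard σ) (W : D.Node → Bool → ℤ) {v u : Bool}
    (hu : (c, k) ∈ σ ↔ u = true) : D.pairSum σ W c k v u = D.partialSum σ W c v := by
  refine Finset.sum_congr rfl fun t _ => if_congr ?_ rfl rfl
  exact h.oneCircle_attach_cap (fun x hx => mem_attachState hx)
    (mem_attachState_self.trans mem_funSplitAt_self.symm) (hu.trans mem_attachState_none.symm)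

theorem pairSum_eq_zero (h : D.IsCheckerboard σ) (W : D.Node → Bool → ℤ) {v : Bool}
    (hv : (c, k) ∈ σ ↔ ¬ v = true) : D.pairSum σ W c k v v = 0 := by
  refine Finset.sum_eq_zero fun t _ => if_neg ?_
  exact h.not_oneCircle_attach (hv.trans (not_congr mem_attachState_self.symm))
    (hv.trans (not_congr mem_attachState_none.symm))

theorem nodeWeight_attach (h : D.IsCheckerboard σ) (x : D.Node) :
    (D.attach c k e).nodeWeight (D.attachColor σ c k e) (some x) = D.nodeWeight σ x := by
  funext u
  have hb : (x, 1) ∈ σ ↔ decide ((x, 1) ∈ σ) = true := by simp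
  rw [nodeWeight_eq h hb]
  exact nodeWeight_eq (h.attach c k e) (x := some x) hb u

/-- The weights of a node and its neighbour combine. -/
theorem combine_attach (h : D.IsCheckerboard σ) {b : Bool} (hb : (c, 1) ∈ σ ↔ b = true)
    (w : Bool → ℤ) :
    let P := D.partialSum σ (D.nodeWeight σ) c
    let P' := (D.attach c k e).partialSum (D.attachColor σ c k e)
      ((D.attach c k e).nodeWeight (D.attachColor σ c k e)) (some c)
    let w' := if (c, k) ∈ σ then seriesWeight w (e.weight b) else parallelWeight w (e.weight b)
    w false * P' false + w true * P' true = w' false * P false + w' true * P true := by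
  intro P P' w'
  have hn : (D.attach c k e).nodeWeight (D.attachColor σ c k e) none = e.weight b :=
    funext fun u => nodeWeight_eq (h.attach c k e) (x := none) hb u
  have hP' : ∀ v, P' v = e.weight b false * D.pairSum σ (D.nodeWeight σ) c k v false +
      e.weight b true * D.pairSum σ (D.nodeWeight σ) c k v true := by
    intro v
    rw [← hn]
    exact partialSum_attach _ _ (fun x _ => nodeWeight_attach h x) v
  rw [hP', hP']
  by_cases hk : (c, k) ∈ σ
  -- The bigon is shaded. Contracting the old edge leaves the new one in its place (`e1`),
  -- contracting only the new edge leaves the old one deleted (`e2`), and deleting both splits off a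
  -- circle (`e3`).
  · have e1 := fun u => pairSum_through h (D.nodeWeight σ) (c := c) (k := k) (v := true) (u := u)
      (by simp [hk])
    have e2 := pairSum_cap h (D.nodeWeight σ) (c := c) (k := k) (v := false) (u := true)
      (by simp [hk])
    have e3 := pairSum_eq_zero h (D.nodeWeight σ) (c := c) (k := k) (v := false) (by simp [hk])
    rw [e1, e1, e2, e3]
    simp only [w', if_pos hk, seriesWeight, if_true, Bool.false_eq_true, if_false]
    ring
  · have e1 := fun u => pairSum_through h (D.nodeWeight σ) (c := c) (k := k) (v := false) (u := u)
      (by simp [hk])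
    have e2 := pairSum_cap h (D.nodeWeight σ) (c := c) (k := k) (v := true) (u := false)
      (by simp [hk])
    have e3 := pairSum_eq_zero h (D.nodeWeight σ) (c := c) (k := k) (v := true) (by simp [hk])
    rw [e1, e1, e2, e3]
    simp only [w', if_neg hk, parallelWeight, if_true, Bool.false_eq_true, if_false]
    ring

/-- The partial sums omit the weight of `c` and their circles ignore the drawing, so redrawing `c`
changes only the two coefficients. -/
theorem stateSum_setElem (h : D.IsCheckerboard σ) {b : Bool} (hb : (c, 1) ∈ σ ↔ b = true) :
    (D.setElem c e).stateSum σ ((D.setElem c e).nodeWeight σ) =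
      e.weight b false * D.partialSum σ (D.nodeWeight σ) c false +
        e.weight b true * D.partialSum σ (D.nodeWeight σ) c true := by
  have h' : (D.setElem c e).IsCheckerboard σ := h
  have hc : ∀ u, (D.setElem c e).nodeWeight σ c u = e.weight b u := fun u => by
    refine (nodeWeight_eq h' (x := c) hb u).trans ?_
    simp [setElem]
  have hP : ∀ u, (D.setElem c e).partialSum σ ((D.setElem c e).nodeWeight σ) c u =
      D.partialSum σ (D.nodeWeight σ) c u := fun u => by
    refine partialSum_congr (D := D) (W := (D.setElem c e).nodeWeight σ) (fun x hx => ?_) u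
    funext u
    have hb : (x, 1) ∈ σ ↔ decide ((x, 1) ∈ σ) = true := by simp
    rw [nodeWeight_eq h hb]
    refine (nodeWeight_eq h' (x := x) hb u).trans ?_
    simp [setElem, Function.update_of_ne hx]
  exact (stateSum_split (D := D.setElem c e) (σ := σ) _ c).trans
    (congrArg₂ (· + ·) (congrArg₂ (· * ·) (hc false) (hP false))
      (congrArg₂ (· * ·) (hc true) (hP true)))

/-- The state sum after a node has been replaced by a tangle. -/
theorem exists_stateSum_replace (T : TwistTangle) : ∀ (D : Diagram) (c : D.Node)
    (σ : Set D.Flag) (_ : D.IsCheckerboard σ) (_ : Nat.card D.Node + 2 ≤ D.faceCount)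
    (b : Bool) (_ : (c, 1) ∈ σ ↔ b = true),
    ∃ τ, (D.replace c T).IsCheckerboard τ ∧
      Nat.card (D.replace c T).Node + 2 ≤ (D.replace c T).faceCount ∧
      (D.replace c T).stateSum τ ((D.replace c T).nodeWeight τ) =
        T.weight b false * D.partialSum σ (D.nodeWeight σ) c false +
          T.weight b true * D.partialSum σ (D.nodeWeight σ) c true := by
  -- The diagram is quantified after `T`, because `replace` first attaches `e` and then continues in
  -- the enlarged diagram. The face bound persists since every new node brings a new face.
  induction T with
  | elem e => exact fun D c σ h hF b hb => ⟨σ, h, hF, stateSum_setElem h hb⟩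
  | addEast T e ih =>
    intro D c σ h hF b hb
    have hF' : Nat.card (D.attach c 3 e).Node + 2 ≤ (D.attach c 3 e).faceCount := by
      have := D.faceCount_attach c 3 e
      rw [card_attach]; omega
    obtain ⟨τ, h1, h2, h3⟩ := ih (D.attach c 3 e) (some c) (D.attachColor σ c 3 e)
      (h.attach c 3 e) hF' b hb
    refine ⟨τ, h1, h2, h3.trans ((combine_attach h hb (T.weight b)).trans ?_)⟩
    have h3 : (c, (3 : Fin 4)) ∈ σ ↔ b = true := (h.mem_opp c 1).trans hb
    simp only [h3, TwistTangle.weight]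
  | addSouth T e ih =>
    intro D c σ h hF b hb
    have hF' : Nat.card (D.attach c 2 e).Node + 2 ≤ (D.attach c 2 e).faceCount := by
      have := D.faceCount_attach c 2 e
      rw [card_attach]; omega
    obtain ⟨τ, h1, h2, h3⟩ := ih (D.attach c 2 e) (some c) (D.attachColor σ c 2 e)
      (h.attach c 2 e) hF' b hb
    refine ⟨τ, h1, h2, h3.trans ((combine_attach h hb (T.weight b)).trans ?_)⟩
    have h2 : (c, (2 : Fin 4)) ∈ σ ↔ ¬ b = true := (h.mem_succ c 1).trans (not_congr hb)
    simp only [h2, TwistTangle.weight]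
    split_ifs <;> rfl

end StateSum

end Diagram

/-! ### Rational tangles and continued fractions. -/

/-- A tangle built from one of the two crossingless tangles by adding crossings `e`. -/
def TwistTangle.MadeOf (e : Elem) : TwistTangle → Prop
  | .elem f => f = .vert ∨ f = .horiz
  | .addEast T f => f = e ∧ T.MadeOf e
  | .addSouth T f => f = e ∧ T.MadeOf e

namespace TwistTangle

/-- Reflection exchanges the two weights of a tangle, up to a common sign. -/
theorem weight_reflect {e : Elem} {b : Bool} (he : e.reflect = e) (h0 : e.weight b false = 1)
    (h1 : e.weight b true = -1) (T : TwistTangle) (hT : T.MadeOf e) :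
    T.reflect.MadeOf e ∧ ∃ ε : ℤ, (ε = 1 ∨ ε = -1) ∧
      ∀ u, T.reflect.weight b u = ε * T.weight b (!u) := by
  induction T with
  | elem f =>
    rcases hT with rfl | rfl
    · refine ⟨Or.inr rfl, 1, Or.inl rfl, fun u => ?_⟩
      cases u <;> cases b <;> simp [reflect, Elem.reflect, weight, Elem.weight]
    · refine ⟨Or.inl rfl, 1, Or.inl rfl, fun u => ?_⟩
      cases u <;> cases b <;> simp [reflect, Elem.reflect, weight, Elem.weight]
  | addEast T f ih =>
    obtain ⟨rfl, hT⟩ := hT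
    obtain ⟨hm, ε, hε, hw⟩ := ih hT
    -- With crossing weights `1` and `-1`, combining in series is minus the parallel combination of
    -- the exchanged weights, exchanged back. So every crossing flips the common sign.
    refine ⟨⟨he, hm⟩, -ε, by omega, fun u => ?_⟩
    cases u <;> cases b <;>
      simp only [reflect, weight, he, seriesWeight, parallelWeight, hw, h0, h1, if_true,
        Bool.false_eq_true, if_false, Bool.not_true, Bool.not_false] <;> ring
  | addSouth T f ih =>
    obtain ⟨rfl, hT⟩ := hT
    obtain ⟨hm, ε, hε, hw⟩ := ih hT
    refine ⟨⟨he, hm⟩, -ε, by omega, fun u => ?_⟩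
    cases u <;> cases b <;>
      simp only [reflect, weight, he, seriesWeight, parallelWeight, hw, h0, h1, if_true,
        Bool.false_eq_true, if_false, Bool.not_true, Bool.not_false] <;> ring

/-- One crossing turns the pair of weights at `b` and `!b` from `(v, w)` into `(v, w - v)`, with an
extra common sign `-1` in the series case `b = true`. -/
theorem weight_iterate_addEast {e : Elem} {b : Bool} (h0 : e.weight b false = 1)
    (h1 : e.weight b true = -1) (T : TwistTangle) (hT : T.MadeOf e) (n : ℕ) :
    ((fun T => addEast T e)^[n] T).MadeOf e ∧ ∃ ε : ℤ, (ε = 1 ∨ ε = -1) ∧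
      ((fun T => addEast T e)^[n] T).weight b b = ε * T.weight b b ∧
      ((fun T => addEast T e)^[n] T).weight b (!b) =
        ε * (T.weight b (!b) - n * T.weight b b) := by
  induction n with
  | zero => exact ⟨hT, 1, Or.inl rfl, by simp, by simp⟩
  | succ n ih =>
    obtain ⟨hm, ε, hε, w1, w2⟩ := ih
    rw [Function.iterate_succ_apply']
    refine ⟨⟨rfl, hm⟩, if b = true then -ε else ε, by split_ifs <;> omega, ?_⟩
    cases b <;> simp only [Bool.not_true, Bool.not_false] at w1 w2 <;>
      simp only [weight, seriesWeight, parallelWeight, h0, h1, if_true, w1, w2,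
        Bool.false_eq_true, if_false, Bool.not_true, Bool.not_false] <;>
      push_cast <;> constructor <;> ring

/-- The weights of a rational tangle are, up to sign, the denominator and the numerator of its
slope. -/
theorem weight_rational {e : Elem} {b : Bool} {s : ℤ} (he : e.reflect = e)
    (h0 : e.weight b false = 1) (h1 : e.weight b true = -1) (hs : s = 1 ∨ s = -1)
    (hse : ∀ m : ℤ, 0 < s * m → (if 0 < m then Elem.pos else Elem.neg) = e)
    (a : List ℤ) (ha : ∀ m ∈ a, 0 < s * m) :
    (rational a).MadeOf e ∧ ∃ ε A B : ℤ, (ε = 1 ∨ ε = -1) ∧ 0 < A ∧ 0 ≤ B ∧ IsCoprime A B ∧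
      (rational a).weight b (!b) = ε * A ∧ (rational a).weight b b = -(ε * B) ∧
      contFrac a = ((s * B : ℤ) : ℚ) / (A : ℚ) := by
  induction a using List.reverseRecOn with
  | nil =>
    refine ⟨Or.inl rfl, 1, 1, 0, Or.inl rfl, one_pos, le_rfl, isCoprime_one_left, ?_, ?_, ?_⟩
    · cases b <;> simp [rational, weight, Elem.weight]
    · simp [rational, weight, Elem.weight]
    · simp [contFrac]
  | append_singleton a m ih =>
    obtain ⟨hm, ε, A, B, hε, hA, hB, hAB, wV, wH, hq⟩ :=
      ih fun m hm => ha m (List.mem_append_left _ hm)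
    have hsm : 0 < s * m := ha m (by simp)
    have hrat : rational (a ++ [m]) = (fun T => addEast T e)^[m.natAbs] (rational a).reflect := by
      have hfold : rational (a ++ [m]) = (rational a).reflect.twist m := by
        simp only [rational, List.foldl_append, List.foldl_cons, List.foldl_nil]
      rw [hfold, twist, hse m hsm]
    have hfrac : contFrac (a ++ [m]) = 1 / ((m : ℚ) + contFrac a) := by
      simp [contFrac, List.flatMap_append, List.foldl_append]
    have habs : (m.natAbs : ℤ) = s * m := by
      rcases hs with rfl | rfl <;> omega
    obtain ⟨hm1, δ, hδ, hw⟩ := weight_reflect he h0 h1 _ hm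
    obtain ⟨hm2, γ, hγ, w1, w2⟩ := weight_iterate_addEast h0 h1 _ hm1 m.natAbs
    rw [hrat]
    -- Reflection exchanges `A` and `B`, and `|m| = s * m` further crossings add `|m|` times the one
    -- to the other. This matches `1 / (m + s B / A) = s A / (s m A + B)`.
    refine ⟨hm2, -(γ * δ * ε), s * m * A + B, A, ?_, by positivity, hA.le, ?_, ?_, ?_, ?_⟩
    · rcases hγ with rfl | rfl <;> rcases hδ with rfl | rfl <;> rcases hε with rfl | rfl <;> simp
    · rw [add_comm, IsCoprime.add_mul_right_left_iff]
      exact hAB.symm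
    · rw [w2, hw, hw, Bool.not_not, wV, wH, habs]
      ring
    · rw [w1, hw, wV]
      ring
    · have hss : (s : ℚ) * s = 1 := by rcases hs with rfl | rfl <;> norm_num
      have hA' : (A : ℚ) ≠ 0 := by exact_mod_cast hA.ne'
      have hne : ((s * m * A + B : ℤ) : ℚ) ≠ 0 := by
        exact_mod_cast (by positivity : 0 < s * m * A + B).ne'
      have e1 : (m : ℚ) + ((s * B : ℤ) : ℚ) / A = s * ((s * m * A + B : ℤ) : ℚ) / A := by
        field_simp
        push_cast
        linear_combination (-(m : ℚ) * A) * hss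
      have hs0 : (s : ℚ) ≠ 0 := left_ne_zero_of_mul_eq_one hss
      rw [hfrac, hq, e1]
      field_simp
      push_cast
      linear_combination (-(A : ℚ)) * hss

end TwistTangle

/-! ### Determinants of the smoothings and of the replaced diagram. -/

namespace Diagram

variable {D : Diagram} {σ : Set D.Flag} {c : D.Node}

/-- The only consequence of planarity that enters: `F = V + 2 C`, and `c` lies in some component. -/
theorem add_two_le_faceCount (hD : D.IsPlanar) (c : D.Node) :
    Nat.card D.Node + 2 ≤ D.faceCount := by
  have := D.finite
  have h1 : 0 < Nat.card (Quot fun x y : D.Node => ∃ i, (D.glue (x, i)).1 = y) :=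
    Nat.card_pos_iff.2 ⟨⟨Quot.mk _ c⟩, inferInstance⟩
  unfold IsPlanar at hD
  unfold faceCount
  omega

/-- The tree sum is identified only for `p ≠ 0`. For `p = 0` the diagram may be disconnected; its
Tait graph can still be connected, through a shaded region that is not a disc, and have a nonzero
tree sum. -/
theorem det_setElem (h : D.IsCheckerboard σ) (hF : Nat.card D.Node + 2 ≤ D.faceCount) {b : Bool}
    (hb : (c, 1) ∈ σ ↔ b = true) (e : Elem) {p : ℤ}
    (hp : e.weight b false * D.partialSum σ (D.nodeWeight σ) c false +
      e.weight b true * D.partialSum σ (D.nodeWeight σ) c true = p) :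
    ((D.setElem c e).det : ℤ) = |p| ∧ (p ≠ 0 → (D.setElem c e).treeSum σ = p) := by
  have h' : (D.setElem c e).IsCheckerboard σ := h
  have hs := (stateSum_setElem (e := e) h hb).trans hp
  refine ⟨(det_eq_abs_stateSum h' fun _ => hF).trans (congrArg _ hs), fun h0 => ?_⟩
  have hconn : (D.setElem c e).IsConnected := by
    by_contra hn
    exact h0 (hs.symm.trans (stateSum_eq_zero h' hn))
  exact (treeSum_eq_stateSum h' hconn hF).trans hs

theorem shiftedTreeSum_eq (D : Diagram) (σ : Set D.Flag) : D.shiftedTreeSum σ = -D.treeSum σ := by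
  unfold shiftedTreeSum treeSum
  rw [← Finset.sum_neg_distrib]
  exact Finset.sum_congr rfl fun v _ => by ring

end Diagram

/-- If `p` or `q` vanishes, only one term is left and its sign is irrelevant; so `z` matters only
when both are nonzero. -/
theorem abs_mul_sub_mul_eq {A B p q z : ℤ} (hz : p ≠ 0 → q ≠ 0 → z = -(p * q)) :
    |A * p - B * q| = |(A * |p| + sgn z * B * |q|)| := by
  have hsgn : |sgn z| = 1 := by unfold sgn; split_ifs <;> simp
  by_cases hp : p = 0
  · subst hp
    simp only [mul_zero, zero_sub, abs_neg, abs_zero, zero_add, abs_mul, hsgn, one_mul, abs_abs]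
  by_cases hq : q = 0
  · subst hq
    simp only [mul_zero, sub_zero, abs_zero, add_zero, abs_mul, abs_abs]
  rw [hz hp hq]
  unfold sgn
  rcases lt_or_gt_of_ne hp with hp | hp <;> rcases lt_or_gt_of_ne hq with hq | hq
  · rw [if_neg (by nlinarith), abs_of_neg hp, abs_of_neg hq, ← abs_neg]
    congr 1; ring
  · rw [if_pos (by nlinarith), abs_of_neg hp, abs_of_pos hq, ← abs_neg]
    congr 1; ring
  · rw [if_pos (by nlinarith), abs_of_pos hp, abs_of_neg hq]
    congr 1; ring
  · rw [if_neg (by nlinarith), abs_of_pos hp, abs_of_pos hq]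
    congr 1; ring

theorem eq_of_coprime_div_eq {α β A B : ℤ} (hα : 0 < α) (hA : 0 < A) (h : IsCoprime α β)
    (h' : IsCoprime A B) (hq : (B : ℚ) / A = (β : ℚ) / α) : A = α ∧ B = β := by
  have := Rat.div_int_inj hA hα (Int.isCoprime_iff_nat_coprime.1 h'.symm)
    (Int.isCoprime_iff_nat_coprime.1 h.symm) hq
  exact ⟨this.2, this.1⟩

/-- The determinant after a crossing has been replaced by a rational tangle, in terms of the
contributions `p`, `q` of the two smoothings. -/
theorem Diagram.det_replace_rational {D : Diagram} {σ : Set D.Flag} {c : D.Node}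
    (h : D.IsCheckerboard σ) (hF : Nat.card D.Node + 2 ≤ D.faceCount) {e : Elem} {b : Bool} {s : ℤ}
    (hb : (c, 1) ∈ σ ↔ b = true) (he : e.reflect = e)
    (h0 : e.weight b false = 1) (h1 : e.weight b true = -1) (hs : s = 1 ∨ s = -1)
    (hse : ∀ m : ℤ, 0 < s * m → (if 0 < m then Elem.pos else Elem.neg) = e)
    {a : List ℤ} (ha : ∀ m ∈ a, 0 < s * m) {α β : ℤ} (hα : 0 < α) (hαβ : IsCoprime α β)
    (hslope : contFrac a = (β : ℚ) / α) :
    0 ≤ s * β ∧ ((D.replace c (TwistTangle.rational a)).det : ℤ) =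
      |α * D.partialSum σ (D.nodeWeight σ) c (!b) -
        s * β * D.partialSum σ (D.nodeWeight σ) c b| := by
  obtain ⟨-, ε, A, B, hε, hA, hB, hAB, wV, wH, hq⟩ :=
    TwistTangle.weight_rational he h0 h1 hs hse a ha
  obtain ⟨τ, t1, t2, t3⟩ :=
    exists_stateSum_replace (TwistTangle.rational a) D c σ h hF b hb
  have hss : s * s = 1 := by rcases hs with rfl | rfl <;> norm_num
  have hunit : IsUnit s := Int.isUnit_iff.2 hs
  -- Lowest terms with positive denominator are unique, hence `A = α` and `s * B = β`.
  obtain ⟨rfl, rfl⟩ := eq_of_coprime_div_eq hα hA hαβ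
    ((isCoprime_mul_unit_left_right hunit A B).2 hAB) (hq.symm.trans hslope)
  have hsB : s * (s * B) = B := by rw [← mul_assoc, hss, one_mul]
  rw [hsB]
  refine ⟨hB, ?_⟩
  have hval : (TwistTangle.rational a).weight b false * D.partialSum σ (D.nodeWeight σ) c false +
      (TwistTangle.rational a).weight b true * D.partialSum σ (D.nodeWeight σ) c true =
      ε * (A * D.partialSum σ (D.nodeWeight σ) c (!b) -
        B * D.partialSum σ (D.nodeWeight σ) c b) := by
    cases b <;> simp only [Bool.not_true, Bool.not_false] at wV ⊢ <;> rw [wV, wH] <;> ring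
  rw [det_eq_abs_stateSum t1 fun _ => t2, t3, hval, abs_mul]
  rcases hε with rfl | rfl <;> simp

theorem lemma2p2 (D : Diagram) (hD : D.IsPlanar) (c : D.Node)
    (σ : Set D.Flag) (hσ : D.IsCheckerboard σ) (hc : D.IsPositiveEdge σ c)
    (x y : ℤ) (hx : x = (D.smoothA c).shiftedTreeSum σ) (hy : y = (D.smoothB c).treeSum σ)
    (a : List ℤ) (ha : a ≠ []) (α β : ℤ) (hα : 0 < α) (hαβ : IsCoprime α β)
    (hslope : contFrac a = (β : ℚ) / α) :
    (D.elem c = Elem.pos → (∀ m ∈ a, 0 < m) →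
      ((D.replace c (TwistTangle.rational a)).det : ℤ) =
        |α * (D.smoothA c).det + sgn (x * y) * β * (D.smoothB c).det|) ∧
    (D.elem c = Elem.neg → (∀ m ∈ a, m < 0) →
      ((D.replace c (TwistTangle.rational a)).det : ℤ) =
        |α * (D.smoothB c).det + sgn (x * y) * |β| * (D.smoothA c).det|) := by
  have hF := Diagram.add_two_le_faceCount hD c
  have hx' : x = -(D.smoothA c).treeSum σ := hx.trans (Diagram.shiftedTreeSum_eq _ _)
  constructor
  · intro hpos hm
    -- For a positive edge at a crossing of sign `1` the corners W and E are shaded.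
    have hb : (c, (1 : Fin 4)) ∈ σ ↔ true = true := by
      rcases hc with hc | hc
      · simp [hc.2]
      · rw [hpos] at hc; simp at hc
    have hA : (D.elem c).smoothA = .vert := by rw [hpos]; rfl
    have hB : (D.elem c).smoothB = .horiz := by rw [hpos]; rfl
    obtain ⟨dA, tA⟩ := Diagram.det_setElem hσ hF hb (D.elem c).smoothA
      (p := D.partialSum σ (D.nodeWeight σ) c false) (by simp [hA, Elem.weight])
    obtain ⟨dB, tB⟩ := Diagram.det_setElem hσ hF hb (D.elem c).smoothB
      (p := D.partialSum σ (D.nodeWeight σ) c true) (by simp [hB, Elem.weight])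
    obtain ⟨-, hdet⟩ := Diagram.det_replace_rational (e := .pos) (s := 1) hσ hF hb rfl rfl rfl
      (Or.inl rfl) (fun m hm => if_pos (by simpa using hm)) (fun m h' => by simpa using hm m h')
      hα hαβ hslope
    change ((D.smoothA c).det : ℤ) = _ at dA
    change ((D.smoothB c).det : ℤ) = _ at dB
    change _ → (D.smoothA c).treeSum σ = _ at tA
    change _ → (D.smoothB c).treeSum σ = _ at tB
    rw [hdet, dA, dB, one_mul, Bool.not_true]
    exact abs_mul_sub_mul_eq fun hp hq => by rw [hx', hy, tA hp, tB hq]; ring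
  · intro hneg hm
    -- Now W and E are unshaded. The A-smoothing still deletes the edge, but with `b = false` the
    -- partial sums trade the factors `α` and `|β|`.
    have hb : (c, (1 : Fin 4)) ∈ σ ↔ false = true := by
      rcases hc with hc | hc
      · rw [hneg] at hc; simp at hc
      · have := hσ.mem_succ c 0
        rw [zero_add] at this
        simp [this, hc.2]
    have hA : (D.elem c).smoothA = .horiz := by rw [hneg]; rfl
    have hB : (D.elem c).smoothB = .vert := by rw [hneg]; rfl
    obtain ⟨dA, tA⟩ := Diagram.det_setElem hσ hF hb (D.elem c).smoothA
      (p := D.partialSum σ (D.nodeWeight σ) c false) (by simp [hA, Elem.weight])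
    obtain ⟨dB, tB⟩ := Diagram.det_setElem hσ hF hb (D.elem c).smoothB
      (p := D.partialSum σ (D.nodeWeight σ) c true) (by simp [hB, Elem.weight])
    obtain ⟨hβ, hdet⟩ := Diagram.det_replace_rational (e := .neg) (s := -1) hσ hF hb rfl rfl rfl
      (Or.inr rfl) (fun m hm => if_neg (by omega)) (fun m h' => by have := hm m h'; omega)
      hα hαβ hslope
    change ((D.smoothA c).det : ℤ) = _ at dA
    change ((D.smoothB c).det : ℤ) = _ at dB
    change _ → (D.smoothA c).treeSum σ = _ at tA
    change _ → (D.smoothB c).treeSum σ = _ at tB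
    have habs : |β| = -1 * β := by rw [abs_of_nonpos (by omega)]; ring
    rw [hdet, dA, dB, habs, Bool.not_false]
    exact abs_mul_sub_mul_eq fun hp hq => by rw [hx', hy, tA hq, tB hp]; ring
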